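/- A composition is a finite (possibly empty) sequence $\alpha=(\alpha_1,\dots,\alpha_k)$ of positive integers; it is a composition of $n=|\alpha|=\alpha_1+\dots+\alpha_k$. Its set of partial sums is $S_\alpha=\{\alpha_1,\alpha_1+\alpha_2,\dots,\alpha_1+\dots+\alpha_{k-1}\}\subseteq[n-1]$. For a word $w$ of length $n$ in the integers, $\mathcal C(w)$ denotes the composition $\alpha$ of $n$ whose set $S_\alpha$ is the descent set $\{i : w_i>w_{i+1}\}$; for each composition $\alpha$ of $n$ let $w_\alpha$ be a permutation of $1,\dots,n$ with $\mathcal C(w_\alpha)=\alpha$. Let $\mathfrak{M}\mathrm{NSym}$ be the free $\mathbb Z$-module with basis $\{\tilde R_\alpha\}$ indexed by all compositions, with the following structure maps. * Product: $\tilde R_\emptyset=1$, and for nonempty $\alpha=(\alpha_1,\dots,\alpha_k)$ and $\beta=(\beta_1,\dots,\beta_m)$, $$\tilde R_\alpha\bullet\tilde R_\beta=\tilde R_{(\alpha_1,\dots,\alpha_k,\beta_1,\dots,\beta_m)}+\tilde R_{(\alpha_1,\dots,\alpha_{k-1},\alpha_k+\beta_1-1,\beta_2,\dots,\beta_m)}+\tilde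 R_{(\alpha_1,\dots,\alpha_{k-1},\alpha_k+\beta_1,\beta_2,\dots,\beta_m)}.$$ * Coproduct: $\Delta(\tilde R_\alpha)=\sum_{\beta,\delta}c^{\alpha}_{\beta,\delta}\,\tilde R_\beta\otimes\tilde R_\delta$, where $c^\alpha_{\beta,\delta}$ is the number of multishuffles $u$ of $w_\beta$ and $w_\delta[|\beta|]$ with $\mathcal C(u)=\alpha$. Here $w[i]$ is $w$ with $i$ added to each letter. A multiword of a word $a_1\cdots a_k$ is a word $a_{t(1)}\cdots a_{t(r)}$ with $t:[r]\to[k]$ nondecreasing and surjective. A multishuffle of two words $a,b$ with distinct and disjoint letters is a word in the letters of $a$ and $b$ in which no two consecutive letters are equal and whose restrictions to the letters of $a$ and of $b$ are multiwords of $a$ and of $b$, respectively. * Counit: $\epsilon(\tilde R_\emptyset)=1$ and $\epsilon(\tilde R_\alpha)=0$ for $\alpha\ne\emptyset$. An antipode is a $\mathbb Z$-linear map $S:\mathfrak{M}\mathrm{NSym}\to\mathfrak{M}\mathrm{NSym}$ with $\mathrm{id}*S=S*\mathrm{id}=\eta\circ\epsilon$, where $f*g=m\circ(f\otimes g)\circ\Delta$,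 $m$ is the product and $\eta$ is the unit map $\mathbb Z\to\mathfrak{M}\mathrm{NSym}$. Identify a composition with the ribbon diagram whose row lengths from bottom to top are its parts. Let $\omega(\alpha)$ be the conjugate ribbon: the composition of $|\alpha|$ whose set of partial sums is the complement in $[|\alpha|-1]$ of the set of partial sums of the reversal of $\alpha$. Let $M_{\gamma,\beta}$ be the number of ways to obtain the ribbon $\beta$ from the ribbon $\gamma$ by merging boxes that share an edge, that is, the number of sets of shared edges of $\gamma$ such that merging the boxes along these edges, while all other adjacencies keep their direction (horizontal or vertical), gives $\beta$. **Theorem.** $\mathfrak{M}\mathrm{NSym}$ has a unique antipode $S$, and for every composition $\alpha$ of $n$, $$S(\tilde R_\alpha)=(-1)^n\sum_{\beta}M_{\omega(\alpha),\beta}\,\tilde R_\beta,$$ where the sum is over all compositions $\beta$ and has only finitely many nonzero terms. -/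

import Mathlib

open scoped TensorProduct

/-! ### Compositions, descent sets and ribbons

A composition is a finite list of positive integers; the empty list is the composition of `0`. -/

/-- The size `|α| = α₁ + ⋯ + α_k`; `α` is a composition of `n` when `compSize α = n`. -/
def compSize (α : List ℕ+) : ℕ := (α.map (fun a : ℕ+ => (a : ℕ))).sum

/-- The ribbon of a composition of `n ≥ 1`, given by the directions of the `n - 1` edges shared by
consecutive boxes, from the bottom left box to the top right box (the parts of the composition are
the row lengths from bottom to top): `false` means that the next box is to the right in the same
row, `true` that it is above and starts the next row.  Equivalently, the `i`-th entry says whether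
`i` is one of the partial sums `α₁, α₁ + α₂, …, α₁ + ⋯ + α_{k-1}`. -/
def ribbonSteps : List ℕ+ → List Bool
  | [] => []
  | [a] => List.replicate ((a : ℕ) - 1) false
  | a :: b :: l => List.replicate ((a : ℕ) - 1) false ++ true :: ribbonSteps (b :: l)

/-- The nonempty composition whose ribbon has the given steps. -/
def ofRibbonSteps : List Bool → List ℕ+
  | [] => [1]
  | true :: s => 1 :: ofRibbonSteps s
  | false :: s =>
    match ofRibbonSteps s with
    | [] => [1]
    | a :: l => (a + 1) :: l

/-- The composition `𝒞(w)` associated to the descent set `{i | w_i > w_{i+1}}` of a word `w`. -/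
def descentComp : List ℕ → List ℕ+
  | [] => []
  | x :: w => ofRibbonSteps (List.zipWith (fun a b => decide (b < a)) (x :: w) w)

/-- The conjugate `ω(α)`: the composition of `|α|` whose set of partial sums is the complement in
`{1, …, |α| - 1}` of the set of partial sums of the reversal of `α`. -/
def conjComp : List ℕ+ → List ℕ+
  | [] => []
  | a :: l => ofRibbonSteps ((ribbonSteps (a :: l).reverse).map (fun b => !b))

/-! ### Merging the boxes of a ribbon -/

/-- The ribbon obtained from the ribbon `α` by merging the two boxes at each of the shared edges
whose position (numbered from `0`) lies in `K`; the remaining edges keep their directions. -/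
def mergeRibbon (α : List ℕ+) (K : Finset ℕ) : List ℕ+ :=
  match α with
  | [] => []
  | a :: l =>
    ofRibbonSteps
      (((ribbonSteps (a :: l)).zipIdx.filter (fun p => decide (p.2 ∉ K))).map Prod.fst)

/-- `M_{α,β}`: the number of ways to choose a set of shared edges of the ribbon `α` such that
merging the boxes along these edges gives the ribbon `β`. -/
def mergeCount (α β : List ℕ+) : ℕ :=
  ((Finset.range (ribbonSteps α).length).powerset.filter (fun K => mergeRibbon α K = β)).card

/-! ### Multishuffles -/

/-- `w` is a multiword of `a`: there is a nondecreasing surjection `t` from the positions of `w`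
onto the positions of `a` with `w_j = a_{t(j)}`. -/
def IsMultiword (w a : List ℕ) : Prop :=
  ∃ t : Fin w.length → Fin a.length,
    Monotone t ∧ Function.Surjective t ∧ ∀ j, w.get j = a.get (t j)

/-- `w` is a multishuffle of the words `a` and `b`. -/
def IsMultishuffle (w a b : List ℕ) : Prop :=
  (∀ x ∈ w, x ∈ a ∨ x ∈ b) ∧ w.IsChain (· ≠ ·) ∧
    IsMultiword (w.filter (fun x => decide (x ∈ a))) a ∧
    IsMultiword (w.filter (fun x => decide (x ∈ b))) b

/-- A permutation `w_α` of `1, …, |α|` (in one-line notation) with `𝒞(w_α) = α`: increasing runs of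
lengths `α₁, …, α_k`, each run consisting of larger numbers than the runs after it. -/
def compWord : List ℕ+ → List ℕ
  | [] => []
  | a :: l => List.range' (compSize l + 1) a ++ compWord l

theorem compWord_length (α : List ℕ+) : (compWord α).length = compSize α := by
  induction α with
  | nil => rfl
  | cons a l ih => simp [compWord, compSize, ih]

theorem compWord_perm (α : List ℕ+) : (compWord α).Perm (List.range' 1 (compSize α)) := by
  induction α with
  | nil => exact List.Perm.refl _
  | cons a l ih =>
    have h : compSize (a :: l) = compSize l + a := by simp [compSize, add_comm]
    rw [h, ← List.range'_append_1, compWord, add_comm (compSize l) 1]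
    exact List.perm_append_comm.trans (ih.append_right _)

theorem descentComp_range'_append (k m : ℕ) (w : List ℕ) (hw : ∀ x ∈ w, x < m) :
    descentComp (List.range' m (k + 1) ++ w) = k.succPNat :: descentComp w := by
  induction k generalizing m with
  | zero =>
    match w with
    | [] => rfl
    | y :: w =>
      have : y < m := hw y (by simp)
      simp [descentComp, ofRibbonSteps, this]
      rfl
  | succ k ih =>
    have h := ih (m + 1) (fun x hx => Nat.lt_succ_of_lt (hw x hx))
    rw [List.range'_succ, List.cons_append] at h ⊢
    rw [List.range'_succ, List.cons_append]
    simp only [descentComp, List.zipWith_cons_cons] at h ⊢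
    have hm : decide (m + 1 < m) = false := by simp
    rw [hm, ofRibbonSteps, h]
    rfl

theorem descentComp_compWord (α : List ℕ+) : descentComp (compWord α) = α := by
  induction α with
  | nil => rfl
  | cons a l ih =>
    have ha : (a : ℕ) = a.natPred + 1 := by simp
    rw [compWord, ha, descentComp_range'_append, ih]
    · simp
    · intro x hx
      have := (compWord_perm l).mem_iff.1 hx
      rw [List.mem_range'_1] at this
      omega

/-- The number of multishuffles `u` of `w_β` and `w_δ[|β|]` with `𝒞(u) = α`. -/
noncomputable def coprodCoeff (α β δ : List ℕ+) : ℕ :=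
  {u : List ℕ | IsMultishuffle u (compWord β) ((compWord δ).map (· + compSize β)) ∧
    descentComp u = α}.ncard

theorem compSize_descentComp (w : List ℕ) : compSize (descentComp w) = w.length := by
  have h : ∀ s, compSize (ofRibbonSteps s) = s.length + 1 := by
    intro s
    induction s with
    | nil => rfl
    | cons b s ih =>
      cases b with
      | true => simp [ofRibbonSteps, compSize] at ih ⊢; omega
      | false =>
        rw [ofRibbonSteps]
        split
        · rename_i h; rw [h] at ih; simp [compSize] at ih
        · rename_i h; rw [h] at ih; simp [compSize] at ih ⊢; omega
  cases w with
  | nil => rfl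
  | cons x w => simp [descentComp, h]

theorem finite_lists {A : Type*} (s : Set A) (hs : s.Finite) (n : ℕ) :
    {l : List A | l.length ≤ n ∧ ∀ x ∈ l, x ∈ s}.Finite := by
  induction n with
  | zero => exact (Set.finite_singleton []).subset (fun l hl => by simpa using hl.1)
  | succ n ih =>
    refine ((Set.finite_singleton []).union (Set.Finite.image2 List.cons hs ih)).subset ?_
    rintro (_ | ⟨x, l⟩) ⟨h1, h2⟩
    · exact Or.inl rfl
    · exact Or.inr ⟨x, h2 x (by simp), l,
        ⟨by simpa using h1, fun y hy => h2 y (by simp [hy])⟩, rfl⟩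

theorem finite_compSize_le (n : ℕ) : {α : List ℕ+ | compSize α ≤ n}.Finite := by
  refine (finite_lists {a : ℕ+ | (a : ℕ) ≤ n}
    (Set.Finite.preimage PNat.coe_injective.injOn (Set.finite_Iic n)) n).subset ?_
  intro α hα
  have hα' : compSize α ≤ n := hα
  refine ⟨?_, fun a ha => ?_⟩
  · refine le_trans ?_ hα'
    clear hα hα'
    induction α with
    | nil => simp
    | cons a l ih =>
      have := a.pos
      simp only [compSize, List.map_cons, List.sum_cons, List.length_cons] at ih ⊢
      omega
  · exact le_trans (List.single_le_sum (by simp) _ (List.mem_map_of_mem ha)) hα'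

theorem finite_multishuffles (a b : List ℕ) (α : List ℕ+) :
    {u : List ℕ | IsMultishuffle u a b ∧ descentComp u = α}.Finite := by
  refine (finite_lists {x | x ∈ a ++ b} (List.finite_toSet _) (compSize α)).subset ?_
  rintro u ⟨hu, rfl⟩
  exact ⟨(compSize_descentComp u).ge, fun x hx => by simpa using hu.1 x hx⟩

theorem finite_coprodCoeff_ne_zero (α : List ℕ+) :
    {p : List ℕ+ × List ℕ+ | coprodCoeff α p.1 p.2 ≠ 0}.Finite := by
  refine ((finite_compSize_le (compSize α)).prod (finite_compSize_le (compSize α))).subset ?_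
  rintro ⟨β, δ⟩ h
  obtain ⟨u, hu, rfl⟩ := Set.nonempty_of_ncard_ne_zero h
  have key : ∀ {w a : List ℕ}, IsMultiword w a → a.length ≤ w.length := by
    rintro w a ⟨t, -, ht, -⟩
    simpa using Fintype.card_le_of_surjective t ht
  have h1 := (key hu.2.2.1).trans (List.length_filter_le _ u)
  have h2 := (key hu.2.2.2).trans (List.length_filter_le _ u)
  rw [List.length_map] at h2
  rw [compWord_length] at h1 h2
  exact ⟨by simpa [compSize_descentComp] using h1, by simpa [compSize_descentComp] using h2⟩

/-! ### The algebra and coalgebra of Multi-noncommutative symmetric functions -/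

/-- Multi-noncommutative symmetric functions: the free abelian group on compositions. -/
def MNSym : Type := List ℕ+ →₀ ℤ

namespace MNSym

noncomputable instance instAddCommGroup : AddCommGroup MNSym :=
  inferInstanceAs (AddCommGroup (List ℕ+ →₀ ℤ))

/-- The basis of Multi-noncommutative ribbon functions. -/
noncomputable def ribbonBasis : Module.Basis (List ℕ+) ℤ MNSym :=
  Module.Basis.ofRepr (AddEquiv.refl (List ℕ+ →₀ ℤ)).toIntLinearEquiv

/-- The Multi-noncommutative ribbon function `R̃_α`. -/
noncomputable def R (α : List ℕ+) : MNSym := ribbonBasis α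

/-- Join two nonempty compositions by combining the last part of the first one and the first part
of the second one by `f`. -/
def joinWith (f : ℕ+ → ℕ+ → ℕ+) : List ℕ+ → List ℕ+ → List ℕ+
  | [], β => β
  | α, [] => α
  | [a], b :: β => f a b :: β
  | a :: a' :: α, b :: β => a :: joinWith f (a' :: α) (b :: β)

/-- The product `R̃_α • R̃_β = R̃_{α ◁ β} + R̃_{α · β} + R̃_{α ▷ β}`, with `R̃_∅` as unit. -/
noncomputable def mulRibbon (α β : List ℕ+) : MNSym :=
  if α = [] then R β
  else if β = [] then R α
  else R (α ++ β) + R (joinWith (fun a b => a + b - 1) α β) + R (joinWith (fun a b => a + b) α β)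

/-- The bilinear extension of `mulRibbon`. -/
noncomputable def mulHom : MNSym →ₗ[ℤ] MNSym →ₗ[ℤ] MNSym :=
  ribbonBasis.constr ℤ (fun α => ribbonBasis.constr ℤ (fun β => mulRibbon α β))

theorem mulHom_R (α β : List ℕ+) : mulHom (R α) (R β) = mulRibbon α β := by
  simp [mulHom, R]

theorem joinWith_ne_nil (f : ℕ+ → ℕ+ → ℕ+) {α β : List ℕ+} (hα : α ≠ []) :
    joinWith f α β ≠ [] := by
  match α, β with
  | [], _ => exact absurd rfl hα
  | [a], [] => simp [joinWith]
  | [a], b :: β => simp [joinWith]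
  | a :: a' :: α, [] => simp [joinWith]
  | a :: a' :: α, b :: β => simp [joinWith]

theorem joinWith_cons (f : ℕ+ → ℕ+ → ℕ+) (a : ℕ+) {α β : List ℕ+} (hα : α ≠ []) (hβ : β ≠ []) :
    joinWith f (a :: α) β = a :: joinWith f α β := by
  match α, β with
  | [], _ => exact absurd rfl hα
  | _, [] => exact absurd rfl hβ
  | a' :: α, b :: β => simp [joinWith]

theorem joinWith_assoc (f g : ℕ+ → ℕ+ → ℕ+) (hfg : ∀ a b c, f (g a b) c = g a (f b c))
    {α β γ : List ℕ+} (hα : α ≠ []) (hβ : β ≠ []) (hγ : γ ≠ []) :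
    joinWith f (joinWith g α β) γ = joinWith g α (joinWith f β γ) := by
  induction α with
  | nil => exact absurd rfl hα
  | cons a α ih =>
    by_cases h : α = []
    · subst h
      match β, γ with
      | [], _ => exact absurd rfl hβ
      | _, [] => exact absurd rfl hγ
      | [b], c :: γ => simp [joinWith, hfg]
      | b :: b' :: β, c :: γ => simp [joinWith]
    · rw [joinWith_cons g a h hβ, joinWith_cons f a (joinWith_ne_nil g h) hγ, ih h,
        joinWith_cons g a h (joinWith_ne_nil f hβ)]

theorem joinWith_append_left (f : ℕ+ → ℕ+ → ℕ+) {α β γ : List ℕ+} (hβ : β ≠ []) (hγ : γ ≠ []) :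
    joinWith f (α ++ β) γ = α ++ joinWith f β γ := by
  induction α with
  | nil => rfl
  | cons a α ih => rw [List.cons_append, joinWith_cons f a (by simp [hβ]) hγ, ih]; rfl

theorem joinWith_append_right (f : ℕ+ → ℕ+ → ℕ+) {α β γ : List ℕ+} (hα : α ≠ []) (hβ : β ≠ []) :
    joinWith f α β ++ γ = joinWith f α (β ++ γ) := by
  induction α with
  | nil => exact absurd rfl hα
  | cons a α ih =>
    by_cases h : α = []
    · subst h
      match β with
      | [] => exact absurd rfl hβ
      | b :: β => simp [joinWith]
    · rw [joinWith_cons f a h hβ, joinWith_cons f a h (by simp [hβ]), List.cons_append, ih h]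

theorem coe_add_sub_one (a b : ℕ+) : ((a + b - 1 : ℕ+) : ℕ) = a + b - 1 := by
  have h : (1 : ℕ+) < a + b := by
    rw [← PNat.coe_lt_coe]
    have := a.pos
    have := b.pos
    push_cast
    omega
  simp [PNat.sub_coe, h]

theorem mulHom_assoc_R (α β γ : List ℕ+) :
    mulHom (mulHom (R α) (R β)) (R γ) = mulHom (R α) (mulHom (R β) (R γ)) := by
  by_cases hα : α = []
  · subst hα
    have h : ∀ δ, mulRibbon [] δ = R δ := fun δ => by simp [mulRibbon]
    have h' : ∀ x, mulHom (R []) x = x := fun x => by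
      have : mulHom (R []) = LinearMap.id :=
        ribbonBasis.ext (fun δ => (mulHom_R [] δ).trans (h δ))
      exact LinearMap.congr_fun this x
    rw [h', h']
  by_cases hβ : β = []
  · subst hβ; simp [mulHom_R, mulRibbon, hα]
  by_cases hγ : γ = []
  · subst hγ
    simp only [mulHom_R, mulRibbon, hα, hβ, if_true, if_false, map_add, LinearMap.add_apply]
    simp [hα, joinWith_ne_nil]
  simp only [mulHom_R, mulRibbon, hα, hβ, hγ, if_false, map_add, LinearMap.add_apply]
  simp only [List.append_eq_nil_iff, hα, hβ, hγ, if_false, joinWith_ne_nil _ hα,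
    joinWith_ne_nil _ hβ, false_and]
  have e1 : ∀ a b c : ℕ+, a + b - 1 + c - 1 = a + (b + c - 1) - 1 := by
    intro a b c
    apply PNat.eq
    have := b.pos
    simp only [coe_add_sub_one]
    omega
  have e2 : ∀ a b c : ℕ+, a + b + c - 1 = a + (b + c - 1) := by
    intro a b c
    apply PNat.eq
    have := b.pos
    simp only [coe_add_sub_one, PNat.add_coe]
    omega
  have e3 : ∀ a b c : ℕ+, a + b - 1 + c = a + (b + c) - 1 := by
    intro a b c
    apply PNat.eq
    have := b.pos
    simp only [coe_add_sub_one, PNat.add_coe]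
    omega
  rw [joinWith_append_left _ hβ hγ, joinWith_append_left _ hβ hγ,
    joinWith_append_right _ hα hβ, joinWith_append_right _ hα hβ,
    joinWith_assoc _ _ e1 hα hβ hγ, joinWith_assoc _ _ e3 hα hβ hγ,
    joinWith_assoc _ _ e2 hα hβ hγ, joinWith_assoc _ _ add_assoc hα hβ hγ, List.append_assoc]
  abel

theorem mulHom_assoc (x y z : MNSym) : mulHom (mulHom x y) z = mulHom x (mulHom y z) := by
  have h1 : ∀ α β z, mulHom (mulHom (R α) (R β)) z = mulHom (R α) (mulHom (R β) z) := by
    intro α β z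
    have h : mulHom (mulHom (R α) (R β)) = mulHom (R α) ∘ₗ mulHom (R β) :=
      ribbonBasis.ext (fun γ => mulHom_assoc_R α β γ)
    exact LinearMap.congr_fun h z
  have h2 : ∀ α y z, mulHom (mulHom (R α) y) z = mulHom (R α) (mulHom y z) := by
    intro α y z
    have h : mulHom.flip z ∘ₗ mulHom (R α) = mulHom (R α) ∘ₗ mulHom.flip z :=
      ribbonBasis.ext (fun β => h1 α β z)
    exact LinearMap.congr_fun h y
  have h : mulHom.flip z ∘ₗ mulHom.flip y = mulHom.flip (mulHom y z) :=
    ribbonBasis.ext (fun α => h2 α y z)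
  exact LinearMap.congr_fun h x

theorem mulHom_one_left (x : MNSym) : mulHom (R []) x = x := by
  have h : mulHom (R []) = LinearMap.id :=
    ribbonBasis.ext (fun α => by change mulHom (R []) (R α) = R α; simp [mulHom_R, mulRibbon])
  exact LinearMap.congr_fun h x

theorem mulHom_one_right (x : MNSym) : mulHom x (R []) = x := by
  have h : mulHom.flip (R []) = LinearMap.id :=
    ribbonBasis.ext (fun α => by
      change mulHom (R α) (R []) = R α
      by_cases hα : α = []
      · subst hα; simp [mulHom_R, mulRibbon]
      · simp [mulHom_R, mulRibbon, hα])
  exact LinearMap.congr_fun h x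

/-- The ring `𝔐NSym`: its product is `•` and its unit is `1 = R̃_∅`. -/
noncomputable instance instRing : Ring MNSym :=
  { instAddCommGroup with
    mul := fun x y => mulHom x y
    one := R []
    left_distrib := fun x y z => map_add (mulHom x) y z
    right_distrib := fun x y z => LinearMap.map_add₂ mulHom x y z
    zero_mul := fun x => LinearMap.map_zero₂ mulHom x
    mul_zero := fun x => map_zero (mulHom x)
    mul_assoc := mulHom_assoc
    one_mul := mulHom_one_left
    mul_one := mulHom_one_right }

theorem one_eq : (1 : MNSym) = R [] := rfl

theorem R_mul_R (α β : List ℕ+) : R α * R β = mulRibbon α β := mulHom_R α β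

/-- The coproduct `Δ(R̃_α) = ∑ R̃_β ⊗ R̃_δ`, the sum being over all `β`, `δ` and all multishuffles of
`w_β` and `w_δ[|β|]` whose descent set is that of `w_α` (finitely many, see
`finite_coprodCoeff_ne_zero`), and the counit, which takes the coefficient of `R̃_∅ = 1`. -/
noncomputable instance instCoalgebraStruct : CoalgebraStruct ℤ MNSym where
  comul := ribbonBasis.constr ℤ (fun α =>
    ∑ᶠ p : List ℕ+ × List ℕ+, (coprodCoeff α p.1 p.2 : ℤ) • (R p.1 ⊗ₜ[ℤ] R p.2))
  counit := ribbonBasis.constr ℤ (fun α => if α = [] then (1 : ℤ) else 0)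

/-- `S` is an antipode: a two-sided inverse of the identity for the convolution product
`f * g = m ∘ (f ⊗ g) ∘ Δ`, whose unit is `η ∘ ε`. -/
def IsAntipode (S : MNSym →ₗ[ℤ] MNSym) : Prop :=
  LinearMap.mul' ℤ MNSym ∘ₗ TensorProduct.map LinearMap.id S ∘ₗ Coalgebra.comul =
      Algebra.linearMap ℤ MNSym ∘ₗ Coalgebra.counit ∧
    LinearMap.mul' ℤ MNSym ∘ₗ TensorProduct.map S LinearMap.id ∘ₗ Coalgebra.comul =
      Algebra.linearMap ℤ MNSym ∘ₗ Coalgebra.counit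

end MNSym

/-!
Write the ribbon of a nonempty composition as the word of its steps in the letters `h` (to the
right) and `v` (upwards), and `[w]` for the ribbon function of the word `w`, extended linearly to
the free algebra on `h` and `v` (`MNSym.ofSteps`).

* The product is `[a] • [b] = [a (h + v + 1) b]` (`MNSym.ofSteps_mul_ofSteps`).
* Merging along all sets of edges is the substitution `h ↦ h + 1`, `v ↦ v + 1`
  (`MNSym.finsum_mergeCount_ofRibbonSteps`), and conjugation reverses the word and exchanges `h`
  and `v`.  Hence the asserted formula says `S [a] = -[ψ a]`, where `ψ` is the anti-endomorphism
  `h ↦ -(v + 1)`, `v ↦ -(h + 1)`.  Since `ψ (h + v + 1) = -(h + v + 1)`, this `S` is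
  anti-multiplicative (`MNSym.antipode_mul`).
* The coproduct is multiplicative (`MNSym.comul_mul`).  A multishuffle is read letter by letter:
  a descent or ascent inside one of the two words consumes a step of that word, while a passage
  from the first word to the second is an ascent and the reverse passage a descent, after which the
  last used letter of the other word may be repeated or the next one may follow by any step.  This
  gives recursions for the two parts of `Δ [w]` according to the word that contains the first
  letter (`MNSym.comulLeft`, `MNSym.comulRight`, `MNSym.comul_ribbon`).  Reading `h + v + 1` forgets
  which word was read last, and therefore splits the coproduct into a product
  (`MNSym.comulLeft_comulRight_join`).
* The ring is generated by the `H_k = [h ^ (k - 1)]` (`MNSym.adjoin_complete`), and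
  `Δ H_n = ∑ H_i ⊗ H_(n - i)` (`MNSym.comul_complete`).  As `Δ` is multiplicative and `S`
  anti-multiplicative, the antipode identities need only be checked on the `H_n`, where they are
  the telescoping sums `∑ aⁱ (a - b) bʲ = aᵏ - bᵏ` with `a = h`, `b = -(v + 1)`, so that
  `a - b = h + v + 1`.
* The antipode is unique because `Δ [w]` is `[w] ⊗ 1` plus terms whose left factors are ribbon
  functions of smaller ribbons, so that `S * id` determines `S` recursively
  (`MNSym.rTensor_comulLeft_comulRight`).
-/

/-! ### Ribbons as words in the edge directions -/

theorem ofRibbonSteps_ne_nil (s : List Bool) : ofRibbonSteps s ≠ [] := by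
  match s with
  | [] => simp [ofRibbonSteps]
  | true :: s => simp [ofRibbonSteps]
  | false :: s => rw [ofRibbonSteps]; split <;> simp

theorem ofRibbonSteps_false_cons {s : List Bool} {a : ℕ+} {l : List ℕ+}
    (h : ofRibbonSteps s = a :: l) : ofRibbonSteps (false :: s) = (a + 1) :: l := by
  rw [ofRibbonSteps, h]

theorem ribbonSteps_one_cons {l : List ℕ+} (hl : l ≠ []) :
    ribbonSteps (1 :: l) = true :: ribbonSteps l := by
  obtain ⟨b, l, rfl⟩ := List.exists_cons_of_ne_nil hl
  simp [ribbonSteps]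

theorem ribbonSteps_add_one_cons (a : ℕ+) (l : List ℕ+) :
    ribbonSteps ((a + 1) :: l) = false :: ribbonSteps (a :: l) := by
  have h : ((a + 1 : ℕ+) : ℕ) - 1 = ((a : ℕ) - 1) + 1 := by
    have := a.pos
    push_cast
    omega
  cases l <;> simp only [ribbonSteps, h, List.replicate_succ, List.cons_append]

theorem ribbonSteps_ofRibbonSteps (s : List Bool) : ribbonSteps (ofRibbonSteps s) = s := by
  induction s with
  | nil => simp [ofRibbonSteps, ribbonSteps]
  | cons c s ih =>
    cases c with
    | true => rw [ofRibbonSteps, ribbonSteps_one_cons (ofRibbonSteps_ne_nil s), ih]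
    | false =>
      obtain ⟨a, l, h⟩ := List.exists_cons_of_ne_nil (ofRibbonSteps_ne_nil s)
      rw [ofRibbonSteps_false_cons h, ribbonSteps_add_one_cons, ← h, ih]

theorem ofRibbonSteps_ribbonSteps {α : List ℕ+} (h : α ≠ []) :
    ofRibbonSteps (ribbonSteps α) = α := by
  induction α with
  | nil => exact absurd rfl h
  | cons a l ih =>
    induction a with
    | one =>
      by_cases hl : l = []
      · subst hl; simp [ribbonSteps, ofRibbonSteps]
      · rw [ribbonSteps_one_cons hl, ofRibbonSteps, ih hl]
    | succ a iha =>
      rw [ribbonSteps_add_one_cons, ofRibbonSteps_false_cons (iha (by simp))]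

theorem ofRibbonSteps_injective : Function.Injective ofRibbonSteps :=
  Function.LeftInverse.injective ribbonSteps_ofRibbonSteps

theorem eq_nil_or_eq_ofRibbonSteps (α : List ℕ+) : α = [] ∨ ∃ s, α = ofRibbonSteps s := by
  by_cases h : α = []
  · exact Or.inl h
  · exact Or.inr ⟨_, (ofRibbonSteps_ribbonSteps h).symm⟩

theorem compSize_ofRibbonSteps (s : List Bool) : compSize (ofRibbonSteps s) = s.length + 1 := by
  induction s with
  | nil => rfl
  | cons c s ih =>
    obtain ⟨a, l, h⟩ := List.exists_cons_of_ne_nil (ofRibbonSteps_ne_nil s)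
    cases c with
    | true => simp [ofRibbonSteps, compSize] at ih ⊢; omega
    | false =>
      rw [ofRibbonSteps_false_cons h]
      rw [h] at ih
      simp [compSize] at ih ⊢
      omega

theorem ribbonSteps_append {α β : List ℕ+} (hα : α ≠ []) (hβ : β ≠ []) :
    ribbonSteps (α ++ β) = ribbonSteps α ++ true :: ribbonSteps β := by
  obtain ⟨b, β, rfl⟩ := List.exists_cons_of_ne_nil hβ
  induction α with
  | nil => exact absurd rfl hα
  | cons a α ih =>
    cases α with
    | nil => simp [ribbonSteps]
    | cons a' α =>
      have := ih (by simp)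
      simp only [List.cons_append] at this
      simp [ribbonSteps, this]

theorem ribbonSteps_reverse (α : List ℕ+) :
    ribbonSteps α.reverse = (ribbonSteps α).reverse := by
  induction α with
  | nil => rfl
  | cons a α ih =>
    by_cases h : α = []
    · subst h; simp [ribbonSteps]
    · rw [List.reverse_cons, ribbonSteps_append (by simpa using h) (by simp), ih]
      obtain ⟨b, α, rfl⟩ := List.exists_cons_of_ne_nil h
      simp [ribbonSteps]

theorem ofRibbonSteps_append_true_cons (s t : List Bool) :
    ofRibbonSteps (s ++ true :: t) = ofRibbonSteps s ++ ofRibbonSteps t := by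
  rw [← ofRibbonSteps_ribbonSteps (α := ofRibbonSteps s ++ ofRibbonSteps t)
    (by simp [ofRibbonSteps_ne_nil]),
    ribbonSteps_append (ofRibbonSteps_ne_nil s) (ofRibbonSteps_ne_nil t)]
  simp only [ribbonSteps_ofRibbonSteps]

namespace MNSym

theorem joinWith_ofRibbonSteps (f : ℕ+ → ℕ+ → ℕ+) (t u : List Bool)
    (hf : ∀ a b, f (a + 1) b = f a b + 1)
    (h : joinWith f [1] (ofRibbonSteps t) = ofRibbonSteps u) (s : List Bool) :
    joinWith f (ofRibbonSteps s) (ofRibbonSteps t) = ofRibbonSteps (s ++ u) := by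
  induction s with
  | nil => exact h
  | cons c s ih =>
    cases c with
    | true =>
      rw [List.cons_append, ofRibbonSteps, ofRibbonSteps,
        joinWith_cons f 1 (ofRibbonSteps_ne_nil s) (ofRibbonSteps_ne_nil t), ih]
    | false =>
      obtain ⟨b, m, hb⟩ := List.exists_cons_of_ne_nil (ofRibbonSteps_ne_nil t)
      obtain ⟨a, l, ha⟩ := List.exists_cons_of_ne_nil (ofRibbonSteps_ne_nil s)
      rw [hb, ha] at ih
      rw [List.cons_append, ofRibbonSteps_false_cons ha, hb]
      cases l with
      | nil =>
        rw [joinWith] at ih ⊢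
        rw [ofRibbonSteps_false_cons ih.symm, hf]
      | cons a' l =>
        rw [joinWith] at ih ⊢
        rw [ofRibbonSteps_false_cons ih.symm]

/-- The ribbon function `R̃_α` of the nonempty composition `α` whose ribbon has steps `s`. -/
noncomputable def ribbon (s : List Bool) : MNSym := R (ofRibbonSteps s)

/-- Multiplying two ribbon functions amounts to inserting between the two words of steps the
element `h + v + 1`, where `h` and `v` are the horizontal and the vertical step. -/
theorem ribbon_mul_ribbon (s t : List Bool) :
    ribbon s * ribbon t = ribbon (s ++ true :: t) + ribbon (s ++ t) + ribbon (s ++ false :: t) := by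
  rw [ribbon, ribbon, R_mul_R, mulRibbon, if_neg (ofRibbonSteps_ne_nil s),
    if_neg (ofRibbonSteps_ne_nil t), ribbon, ofRibbonSteps_append_true_cons,
    joinWith_ofRibbonSteps _ t t, joinWith_ofRibbonSteps _ t (false :: t)]
  · rfl
  · intro a b; ring
  · obtain ⟨b, m, hb⟩ := List.exists_cons_of_ne_nil (ofRibbonSteps_ne_nil t)
    rw [ofRibbonSteps_false_cons hb, hb, joinWith, add_comm]
  · intro a b
    apply PNat.eq
    have := b.pos
    simp only [coe_add_sub_one, PNat.add_coe]
    omega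
  · obtain ⟨b, m, hb⟩ := List.exists_cons_of_ne_nil (ofRibbonSteps_ne_nil t)
    rw [hb, joinWith, List.cons.injEq]
    refine ⟨?_, rfl⟩
    apply PNat.eq
    simp only [coe_add_sub_one, PNat.one_coe]
    omega

/-- Linear maps on `𝔐NSym` that agree on `1` and on the ribbon functions of nonempty ribbons are
equal. -/
theorem linearMap_ext {M : Type*} [AddCommGroup M] {f g : MNSym →ₗ[ℤ] M} (h1 : f 1 = g 1)
    (h : ∀ s, f (ribbon s) = g (ribbon s)) : f = g := by
  refine ribbonBasis.ext (fun α => ?_)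
  obtain rfl | ⟨s, rfl⟩ := eq_nil_or_eq_ofRibbonSteps α
  · exact h1
  · exact h s

@[elab_as_elim]
theorem induction_on {p : MNSym → Prop} (x : MNSym) (one : p 1) (ribbon : ∀ s, p (ribbon s))
    (add : ∀ x y, p x → p y → p (x + y)) (neg : ∀ x, p x → p (-x)) : p x := by
  let A : AddSubgroup MNSym :=
    { carrier := {x | p x}
      add_mem' := fun {x y} hx hy => add x y hx hy
      zero_mem' := by simpa using add _ _ one (neg _ one)
      neg_mem' := fun {x} hx => neg x hx }
  change x ∈ A
  rw [← ribbonBasis.linearCombination_repr x, Finsupp.linearCombination_apply]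
  refine sum_mem (fun α _ => zsmul_mem ?_ _)
  obtain rfl | ⟨s, rfl⟩ := eq_nil_or_eq_ofRibbonSteps α
  · exact one
  · exact ribbon s

/-- The complete homogeneous elements `R̃_(n)`, for `n ≥ 1`, and `1` for `n = 0`. -/
noncomputable def complete : ℕ → MNSym
  | 0 => 1
  | k + 1 => ribbon (List.replicate k false)

theorem adjoin_complete : Algebra.adjoin ℤ (Set.range complete) = ⊤ := by
  have key : ∀ (s : List Bool) (k : ℕ),
      ribbon (List.replicate k false ++ s) ∈ Algebra.adjoin ℤ (Set.range complete) := by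
    intro s
    induction s with
    | nil =>
      intro k
      rw [List.append_nil]
      exact Algebra.subset_adjoin ⟨k + 1, rfl⟩
    | cons c s ih =>
      intro k
      have hk := ih (k + 1)
      rw [List.replicate_succ', List.append_assoc, List.singleton_append] at hk
      cases c with
      | false => exact hk
      | true =>
        -- a vertical step is the difference of a product and the two other joins
        have h : ribbon (List.replicate k false ++ true :: s) =
            complete (k + 1) * ribbon s - ribbon (List.replicate k false ++ s) -
              ribbon (List.replicate k false ++ false :: s) := by
          rw [complete, ribbon_mul_ribbon]; abel
        rw [h]
        exact sub_mem (sub_mem (mul_mem (Algebra.subset_adjoin ⟨k + 1, rfl⟩) (ih 0)) (ih k)) hk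
  rw [eq_top_iff]
  rintro x -
  induction x using induction_on with
  | one => exact one_mem _
  | ribbon s => exact key s 0
  | add x y hx hy => exact add_mem hx hy
  | neg x hx => exact neg_mem hx

end MNSym

/-! ### The antipode as an anti-endomorphism of the free algebra on the two steps -/

namespace MNSym

/-- A word in the steps as a monomial of the free algebra. -/
noncomputable def stepWord (s : List Bool) : FreeAlgebra ℤ Bool :=
  (s.map (FreeAlgebra.ι ℤ)).prod

/-- The linear map from the free algebra on the two steps to `𝔐NSym` that takes a word in the steps
to the ribbon function of the ribbon with these steps. -/
noncomputable def ofSteps : FreeAlgebra ℤ Bool →ₗ[ℤ] MNSym :=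
  (FreeAlgebra.basisFreeMonoid ℤ Bool).constr ℤ (fun s => ribbon s.toList)

theorem basisFreeMonoid_eq_stepWord (s : FreeMonoid Bool) :
    FreeAlgebra.basisFreeMonoid ℤ Bool s = stepWord s.toList := by
  simp [FreeAlgebra.basisFreeMonoid, FreeAlgebra.equivMonoidAlgebraFreeMonoid, stepWord,
    FreeMonoid.lift_apply]
  exact one_smul ℤ _

theorem ofSteps_stepWord (s : List Bool) : ofSteps (stepWord s) = ribbon s := by
  have h := (FreeAlgebra.basisFreeMonoid ℤ Bool).constr_basis ℤ
    (fun s => ribbon s.toList) (FreeMonoid.ofList s)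
  rwa [basisFreeMonoid_eq_stepWord] at h

theorem freeAlgebra_linearMap_ext {M : Type*} [AddCommGroup M]
    {f g : FreeAlgebra ℤ Bool →ₗ[ℤ] M} (h : ∀ s, f (stepWord s) = g (stepWord s)) : f = g :=
  (FreeAlgebra.basisFreeMonoid ℤ Bool).ext fun s => by
    rw [basisFreeMonoid_eq_stepWord]; exact h _

/-- The element `h + v + 1` of the free algebra on the horizontal step `h` and the vertical
step `v`. -/
noncomputable def joinStep : FreeAlgebra ℤ Bool :=
  FreeAlgebra.ι ℤ false + FreeAlgebra.ι ℤ true + 1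

theorem ofSteps_mul_ofSteps (a b : FreeAlgebra ℤ Bool) :
    ofSteps a * ofSteps b = ofSteps (a * joinStep * b) := by
  have h1 : ∀ s t, ofSteps (stepWord s) * ofSteps (stepWord t) =
      ofSteps (stepWord s * joinStep * stepWord t) := by
    intro s t
    have h : stepWord s * joinStep * stepWord t = stepWord (s ++ true :: t) + stepWord (s ++ t) +
        stepWord (s ++ false :: t) := by
      simp only [stepWord, joinStep, List.map_append, List.map_cons, List.prod_append,
        List.prod_cons]
      noncomm_ring
    rw [h]
    simp only [map_add, ofSteps_stepWord, ribbon_mul_ribbon]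
  have h2 : ∀ s b, ofSteps (stepWord s) * ofSteps b = ofSteps (stepWord s * joinStep * b) := by
    intro s b
    have h : LinearMap.mulLeft ℤ (ofSteps (stepWord s)) ∘ₗ ofSteps =
        ofSteps ∘ₗ LinearMap.mulLeft ℤ (stepWord s * joinStep) :=
      freeAlgebra_linearMap_ext (h1 s)
    exact LinearMap.congr_fun h b
  have h : LinearMap.mulRight ℤ (ofSteps b) ∘ₗ ofSteps =
      ofSteps ∘ₗ LinearMap.mulRight ℤ b ∘ₗ LinearMap.mulRight ℤ joinStep :=
    freeAlgebra_linearMap_ext (fun s => h2 s b)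
  exact LinearMap.congr_fun h a

/-- The anti-endomorphism `h ↦ -(v + 1)`, `v ↦ -(h + 1)` of the free algebra on the steps `h`
and `v`. -/
noncomputable def stepAntipode : FreeAlgebra ℤ Bool →ₐ[ℤ] (FreeAlgebra ℤ Bool)ᵐᵒᵖ :=
  FreeAlgebra.lift ℤ (fun c => MulOpposite.op (-(FreeAlgebra.ι ℤ (!c) + 1)))

theorem unop_stepAntipode_joinStep : (stepAntipode joinStep).unop = -joinStep := by
  simp [stepAntipode, joinStep]
  abel

/-- The linear endomorphism of `𝔐NSym` that fixes `1` and is `-[ψ]` on the span of the ribbon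
functions of nonempty ribbons, where `ψ` is the anti-endomorphism `stepAntipode` of the words in
the steps. -/
noncomputable def antipode : MNSym →ₗ[ℤ] MNSym :=
  ribbonBasis.constr ℤ (fun α =>
    if α = [] then 1 else -ofSteps (stepAntipode (stepWord (ribbonSteps α))).unop)

theorem antipode_one : antipode 1 = 1 := by
  have h := ribbonBasis.constr_basis ℤ (fun α =>
    if α = [] then (1 : MNSym) else -ofSteps (stepAntipode (stepWord (ribbonSteps α))).unop) []
  rwa [if_pos rfl] at h

theorem antipode_ribbon (s : List Bool) :
    antipode (ribbon s) = -ofSteps (stepAntipode (stepWord s)).unop := by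
  have h := ribbonBasis.constr_basis ℤ (fun α => if α = [] then (1 : MNSym) else
    -ofSteps (stepAntipode (stepWord (ribbonSteps α))).unop) (ofRibbonSteps s)
  rwa [if_neg (ofRibbonSteps_ne_nil s), ribbonSteps_ofRibbonSteps] at h

theorem antipode_ofSteps (a : FreeAlgebra ℤ Bool) :
    antipode (ofSteps a) = -ofSteps (stepAntipode a).unop := by
  have h : antipode ∘ₗ ofSteps = -(ofSteps ∘ₗ
      (MulOpposite.opLinearEquiv ℤ).symm.toLinearMap ∘ₗ stepAntipode.toLinearMap) :=
    freeAlgebra_linearMap_ext (fun s => by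
      change antipode (ofSteps (stepWord s)) = -ofSteps (stepAntipode (stepWord s)).unop
      rw [ofSteps_stepWord, antipode_ribbon])
  exact LinearMap.congr_fun h a

/-- The map is anti-multiplicative because `stepAntipode` takes `h + v + 1` to its negative. -/
theorem antipode_mul (x y : MNSym) : antipode (x * y) = antipode y * antipode x := by
  have h : (LinearMap.mul ℤ MNSym).compr₂ antipode =
      ((LinearMap.mul ℤ MNSym).flip.compl₁₂ antipode antipode) := by
    refine linearMap_ext ?_ fun s => linearMap_ext ?_ fun t => ?_
    · ext y; simp [antipode_one]
    · simp [antipode_one]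
    · change antipode (ribbon s * ribbon t) = antipode (ribbon t) * antipode (ribbon s)
      rw [← ofSteps_stepWord, ← ofSteps_stepWord, ofSteps_mul_ofSteps]
      simp only [antipode_ofSteps, map_mul, MulOpposite.unop_mul, unop_stepAntipode_joinStep]
      rw [neg_mul_neg, ofSteps_mul_ofSteps, ← map_neg]
      congr 1
      noncomm_ring
  exact LinearMap.congr_fun (LinearMap.congr_fun h x) y

/-! ### Merging edges -/

theorem sum_powerset_mergeRibbon (s : List Bool) :
    ∑ K ∈ (Finset.range s.length).powerset,
        stepWord ((s.zipIdx.filter (fun p => decide (p.2 ∉ K))).map Prod.fst) =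
      (s.map (fun c => FreeAlgebra.ι ℤ c + 1)).prod := by
  induction s using List.reverseRecOn with
  | nil => simp [stepWord]
  | append_singleton s c ih =>
    have hlt : ∀ p ∈ s.zipIdx, p.2 < s.length := fun p hp => by
      have := List.snd_lt_of_mem_zipIdx hp
      omega
    rw [List.length_append, List.length_singleton, Finset.range_add_one,
      Finset.sum_powerset_insert (by simp), List.map_append, List.prod_append, ← ih,
      List.map_singleton, List.prod_singleton, mul_add, mul_one, Finset.sum_mul]
    congr 1
    · refine Finset.sum_congr rfl fun K hK => ?_
      have hK' : s.length ∉ K := fun h => by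
        have := Finset.mem_powerset.1 hK h
        simp at this
      simp [List.zipIdx_append, hK', stepWord]
    · refine Finset.sum_congr rfl fun K hK => ?_
      congr 2
      simp only [List.zipIdx_append, List.filter_append]
      rw [List.filter_congr (q := fun p => decide (p.2 ∉ K))]
      · simp
      · intro p hp
        have := (hlt p hp).ne
        simp [this]

theorem finite_mergeCount_ne_zero (γ : List ℕ+) : {β | mergeCount γ β ≠ 0}.Finite := by
  classical
  refine ((Finset.range (ribbonSteps γ).length).powerset.image
    (mergeRibbon γ)).finite_toSet.subset ?_
  intro β hβ
  obtain ⟨K, hK⟩ := Finset.card_pos.1 (Nat.pos_of_ne_zero hβ)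
  rw [Finset.mem_filter] at hK
  exact Finset.mem_coe.2 (Finset.mem_image.2 ⟨K, hK.1, hK.2⟩)

theorem finsum_mergeCount (γ : List ℕ+) :
    ∑ᶠ β : List ℕ+, (mergeCount γ β : ℤ) • R β =
      ∑ K ∈ (Finset.range (ribbonSteps γ).length).powerset, R (mergeRibbon γ K) := by
  classical
  rw [Finset.sum_comp R (mergeRibbon γ), finsum_eq_sum_of_support_subset]
  · exact Finset.sum_congr rfl fun β _ => by rw [natCast_zsmul, mergeCount]
  · intro β hβ
    have h : mergeCount γ β ≠ 0 := fun h => hβ (by simp [h])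
    obtain ⟨K, hK⟩ := Finset.card_pos.1 (Nat.pos_of_ne_zero h)
    rw [Finset.mem_filter] at hK
    exact Finset.mem_coe.2 (Finset.mem_image.2 ⟨K, hK.1, hK.2⟩)

theorem finsum_mergeCount_ofRibbonSteps (s : List Bool) :
    ∑ᶠ β : List ℕ+, (mergeCount (ofRibbonSteps s) β : ℤ) • R β =
      ofSteps (s.map (fun c => FreeAlgebra.ι ℤ c + 1)).prod := by
  rw [finsum_mergeCount, ← sum_powerset_mergeRibbon, map_sum, ribbonSteps_ofRibbonSteps]
  refine Finset.sum_congr rfl fun K _ => ?_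
  rw [ofSteps_stepWord, ribbon]
  obtain ⟨a, l, h⟩ := List.exists_cons_of_ne_nil (ofRibbonSteps_ne_nil s)
  rw [h, mergeRibbon, ← h, ribbonSteps_ofRibbonSteps]

theorem conjComp_ofRibbonSteps (s : List Bool) :
    conjComp (ofRibbonSteps s) = ofRibbonSteps (s.reverse.map (fun b => !b)) := by
  obtain ⟨a, l, h⟩ := List.exists_cons_of_ne_nil (ofRibbonSteps_ne_nil s)
  rw [h, conjComp, ← h, ribbonSteps_reverse, ribbonSteps_ofRibbonSteps]

theorem unop_stepAntipode_stepWord (s : List Bool) :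
    (stepAntipode (stepWord s)).unop = (-1 : ℤ) ^ s.length •
      ((s.reverse.map (fun b => !b)).map (fun c => FreeAlgebra.ι ℤ c + 1)).prod := by
  induction s with
  | nil => simp [stepWord]
  | cons c s ih =>
    have h : stepWord (c :: s) = FreeAlgebra.ι ℤ c * stepWord s := by simp [stepWord]
    rw [h, map_mul, MulOpposite.unop_mul, ih]
    simp [stepAntipode, pow_succ]
    noncomm_ring

theorem antipode_R (α : List ℕ+) :
    antipode (R α) =
      (-1 : ℤ) ^ compSize α • ∑ᶠ β : List ℕ+, (mergeCount (conjComp α) β : ℤ) • R β := by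
  obtain rfl | ⟨s, rfl⟩ := eq_nil_or_eq_ofRibbonSteps α
  · rw [finsum_mergeCount]
    change antipode 1 = _
    rw [antipode_one]
    simp [conjComp, ribbonSteps, mergeRibbon, compSize, one_eq]
  · rw [conjComp_ofRibbonSteps, finsum_mergeCount_ofRibbonSteps, compSize_ofRibbonSteps]
    change antipode (ribbon s) = _
    rw [antipode_ribbon, unop_stepAntipode_stepWord, map_zsmul, pow_succ]
    simp

end MNSym

/-! ### Two halves of the coproduct and their multiplicativity -/

namespace MNSym

open Coalgebra (counit comul)

theorem counit_one : counit (R := ℤ) (1 : MNSym) = 1 := by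
  have h := ribbonBasis.constr_basis ℤ (fun α => if α = [] then (1 : ℤ) else 0) []
  rwa [if_pos rfl] at h

theorem counit_ribbon (s : List Bool) : counit (R := ℤ) (ribbon s) = 0 := by
  have h := ribbonBasis.constr_basis ℤ (fun α => if α = [] then (1 : ℤ) else 0) (ofRibbonSteps s)
  rwa [if_neg (ofRibbonSteps_ne_nil s)] at h

theorem counit_mul (x y : MNSym) :
    counit (R := ℤ) (x * y) = counit (R := ℤ) x * counit (R := ℤ) y := by
  have h : (LinearMap.mul ℤ MNSym).compr₂ (counit (R := ℤ)) =
      ((LinearMap.mul ℤ ℤ).compl₁₂ counit counit) := by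
    refine linearMap_ext ?_ fun s => linearMap_ext ?_ fun t => ?_
    · ext y; simp [counit_one]
    · simp [counit_one]
    · simp [ribbon_mul_ribbon, counit_ribbon]
  exact LinearMap.congr_fun (LinearMap.congr_fun h x) y

/-- Put the step `c` in front of the ribbon; the empty ribbon goes to `0`. -/
noncomputable def consStep (c : Bool) : MNSym →ₗ[ℤ] MNSym :=
  ribbonBasis.constr ℤ (fun α => if α = [] then 0 else ribbon (c :: ribbonSteps α))

theorem consStep_one (c : Bool) : consStep c 1 = 0 := by
  have h := ribbonBasis.constr_basis ℤ
    (fun α => if α = [] then 0 else ribbon (c :: ribbonSteps α)) []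
  rwa [if_pos rfl] at h

theorem consStep_ribbon (c : Bool) (s : List Bool) : consStep c (ribbon s) = ribbon (c :: s) := by
  have h := ribbonBasis.constr_basis ℤ
    (fun α => if α = [] then 0 else ribbon (c :: ribbonSteps α)) (ofRibbonSteps s)
  rwa [if_neg (ofRibbonSteps_ne_nil s), ribbonSteps_ofRibbonSteps] at h

theorem counit_consStep (c : Bool) (x : MNSym) : counit (R := ℤ) (consStep c x) = 0 := by
  have h : counit (R := ℤ) ∘ₗ consStep c = 0 := by
    refine linearMap_ext ?_ fun s => ?_
    · simp [consStep_one]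
    · simp [consStep_ribbon, counit_ribbon]
  exact LinearMap.congr_fun h x

theorem consStep_mul (c : Bool) (x y : MNSym) :
    consStep c (x * y) = consStep c x * y + counit (R := ℤ) x • consStep c y := by
  have h : (LinearMap.mul ℤ MNSym).compr₂ (consStep c) =
      (LinearMap.mul ℤ MNSym) ∘ₗ consStep c +
        (counit (R := ℤ)).smulRight (consStep c) := by
    refine linearMap_ext ?_ fun s => linearMap_ext ?_ fun t => ?_
    · ext y; simp [counit_one, consStep_one]
    · simp [counit_ribbon]
    · simp [ribbon_mul_ribbon, counit_ribbon, consStep_ribbon]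
  exact LinearMap.congr_fun (LinearMap.congr_fun h x) y

theorem ribbon_nil_mul (x : MNSym) :
    ribbon [] * x =
      consStep false x + consStep true x + x + counit (R := ℤ) x • (ribbon [] - 1) := by
  have h : LinearMap.mulLeft ℤ (ribbon []) = consStep false + consStep true + LinearMap.id +
      (counit (R := ℤ)).smulRight (ribbon [] - 1) := by
    refine linearMap_ext ?_ fun s => ?_
    · simp [counit_one, consStep_one]
    · simp [ribbon_mul_ribbon, counit_ribbon, consStep_ribbon]
      abel
  exact LinearMap.congr_fun h x

mutual

/-- The part of the coproduct of `ribbon s` that comes from the multishuffles whose first letter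
belongs to the first word.  If the second letter belongs to the same word, then the first step of
the multishuffle is the first step of this word.  Otherwise the multishuffle begins with an ascent,
and multiplication by `R̃_(1)` puts a letter before the first word or repeats its first letter. -/
noncomputable def comulLeft : List Bool → MNSym ⊗[ℤ] MNSym
  | [] => ribbon [] ⊗ₜ 1
  | false :: s =>
    (consStep false).rTensor MNSym (comulLeft s) + (ribbon [] ⊗ₜ 1) * comulRight s
  | true :: s => (consStep true).rTensor MNSym (comulLeft s)

/-- The part of the coproduct of `ribbon s` that comes from the multishuffles whose first letter
belongs to the second word; here a passage to the first word is a descent. -/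
noncomputable def comulRight : List Bool → MNSym ⊗[ℤ] MNSym
  | [] => 1 ⊗ₜ ribbon []
  | false :: s => (consStep false).lTensor MNSym (comulRight s)
  | true :: s =>
    (consStep true).lTensor MNSym (comulRight s) + (1 ⊗ₜ ribbon []) * comulLeft s

end

theorem rTensor_counit_comulLeft (s : List Bool) :
    (counit (R := ℤ)).rTensor MNSym (comulLeft s) = 0 := by
  have h1 : ∀ c, (counit (R := ℤ)) ∘ₗ consStep c = 0 := fun c =>
    LinearMap.ext (counit_consStep c)
  have h2 : ∀ z, (counit (R := ℤ)).rTensor MNSym ((ribbon [] ⊗ₜ 1) * z) = 0 := by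
    intro z
    induction z with
    | zero => simp
    | add x y hx hy => rw [mul_add, map_add, hx, hy, add_zero]
    | tmul x y => simp [counit_mul, counit_ribbon]
  match s with
  | [] => simp [comulLeft, counit_ribbon]
  | false :: s =>
    rw [comulLeft, map_add, h2, ← LinearMap.comp_apply, ← LinearMap.rTensor_comp, h1]
    simp
  | true :: s =>
    rw [comulLeft, ← LinearMap.comp_apply, ← LinearMap.rTensor_comp, h1]
    simp

theorem lTensor_counit_comulRight (s : List Bool) :
    (counit (R := ℤ)).lTensor MNSym (comulRight s) = 0 := by
  have h1 : ∀ c, (counit (R := ℤ)) ∘ₗ consStep c = 0 := fun c =>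
    LinearMap.ext (counit_consStep c)
  have h2 : ∀ z, (counit (R := ℤ)).lTensor MNSym ((1 ⊗ₜ ribbon []) * z) = 0 := by
    intro z
    induction z with
    | zero => simp
    | add x y hx hy => rw [mul_add, map_add, hx, hy, add_zero]
    | tmul x y => simp [counit_mul, counit_ribbon]
  match s with
  | [] => simp [comulRight, counit_ribbon]
  | true :: s =>
    rw [comulRight, map_add, h2, ← LinearMap.comp_apply, ← LinearMap.lTensor_comp, h1]
    simp
  | false :: s =>
    rw [comulRight, ← LinearMap.comp_apply, ← LinearMap.lTensor_comp, h1]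
    simp

theorem rTensor_consStep_mul (c : Bool) {z : MNSym ⊗[ℤ] MNSym} (w : MNSym ⊗[ℤ] MNSym)
    (hz : (counit (R := ℤ)).rTensor MNSym z = 0) :
    (consStep c).rTensor MNSym (z * w) = (consStep c).rTensor MNSym z * w := by
  have key : ∀ z : MNSym ⊗[ℤ] MNSym, (consStep c).rTensor MNSym (z * w) =
      (consStep c).rTensor MNSym z * w +
        (1 ⊗ₜ TensorProduct.lid ℤ MNSym ((counit (R := ℤ)).rTensor MNSym z)) *
          (consStep c).rTensor MNSym w := by
    intro z
    induction z with
    | zero => simp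
    | add x y hx hy => simp only [add_mul, map_add, TensorProduct.tmul_add, hx, hy]; abel
    | tmul x y =>
      induction w with
      | zero => simp
      | add x y hx hy => simp only [mul_add, map_add, hx, hy]; abel
      | tmul x' y' =>
        simp [consStep_mul, TensorProduct.add_tmul, TensorProduct.smul_tmul', -zsmul_eq_mul]
        rw [zsmul_eq_mul]
  rw [key, hz]
  simp

theorem lTensor_consStep_mul (c : Bool) {z : MNSym ⊗[ℤ] MNSym} (w : MNSym ⊗[ℤ] MNSym)
    (hz : (counit (R := ℤ)).lTensor MNSym z = 0) :
    (consStep c).lTensor MNSym (z * w) = (consStep c).lTensor MNSym z * w := by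
  have key : ∀ z : MNSym ⊗[ℤ] MNSym, (consStep c).lTensor MNSym (z * w) =
      (consStep c).lTensor MNSym z * w +
        (TensorProduct.rid ℤ MNSym ((counit (R := ℤ)).lTensor MNSym z) ⊗ₜ 1) *
          (consStep c).lTensor MNSym w := by
    intro z
    induction z with
    | zero => simp
    | add x y hx hy => simp only [add_mul, map_add, TensorProduct.add_tmul, hx, hy]; abel
    | tmul x y =>
      induction w with
      | zero => simp
      | add x y hx hy => simp only [mul_add, map_add, hx, hy]; abel
      | tmul x' y' =>
        simp [consStep_mul, TensorProduct.tmul_add, TensorProduct.smul_tmul', -zsmul_eq_mul]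
  rw [key, hz]
  simp

theorem ribbon_nil_tmul_one_mul {z : MNSym ⊗[ℤ] MNSym}
    (hz : (counit (R := ℤ)).rTensor MNSym z = 0) :
    (ribbon [] ⊗ₜ 1) * z =
      (consStep false).rTensor MNSym z + (consStep true).rTensor MNSym z + z := by
  have key : ∀ z : MNSym ⊗[ℤ] MNSym, (ribbon [] ⊗ₜ 1) * z =
      (consStep false).rTensor MNSym z + (consStep true).rTensor MNSym z + z +
        (ribbon [] - 1) ⊗ₜ TensorProduct.lid ℤ MNSym ((counit (R := ℤ)).rTensor MNSym z) := by
    intro z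
    induction z with
    | zero => simp
    | add x y hx hy => simp only [mul_add, map_add, TensorProduct.tmul_add, hx, hy]; abel
    | tmul x y =>
      rw [Algebra.TensorProduct.tmul_mul_tmul, ribbon_nil_mul]
      simp [TensorProduct.add_tmul, TensorProduct.smul_tmul', -zsmul_eq_mul]
  rw [key, hz]
  simp

theorem one_tmul_ribbon_nil_mul {z : MNSym ⊗[ℤ] MNSym}
    (hz : (counit (R := ℤ)).lTensor MNSym z = 0) :
    (1 ⊗ₜ ribbon []) * z =
      (consStep false).lTensor MNSym z + (consStep true).lTensor MNSym z + z := by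
  have key : ∀ z : MNSym ⊗[ℤ] MNSym, (1 ⊗ₜ ribbon []) * z =
      (consStep false).lTensor MNSym z + (consStep true).lTensor MNSym z + z +
        TensorProduct.rid ℤ MNSym ((counit (R := ℤ)).lTensor MNSym z) ⊗ₜ (ribbon [] - 1) := by
    intro z
    induction z with
    | zero => simp
    | add x y hx hy => simp only [mul_add, map_add, TensorProduct.add_tmul, hx, hy]; abel
    | tmul x y =>
      rw [Algebra.TensorProduct.tmul_mul_tmul, ribbon_nil_mul]
      simp [TensorProduct.tmul_add, TensorProduct.smul_tmul', -zsmul_eq_mul]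
  rw [key, hz]
  simp

/-- Both halves of the coproduct turn the product of ribbon functions, which inserts `h + v + 1`
between the words of steps, into the product of the tensor square: reading `h + v + 1` after any
first letter, the next letter may belong to either word, in any position the steps allow. -/
theorem comulLeft_comulRight_join (s t : List Bool) :
    comulLeft (s ++ true :: t) + comulLeft (s ++ t) + comulLeft (s ++ false :: t) =
        comulLeft s * (comulLeft t + comulRight t) ∧
      comulRight (s ++ true :: t) + comulRight (s ++ t) + comulRight (s ++ false :: t) =
        comulRight s * (comulLeft t + comulRight t) := by
  induction s with
  | nil =>
    simp only [List.nil_append, comulLeft, comulRight, mul_add]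
    rw [ribbon_nil_tmul_one_mul (rTensor_counit_comulLeft t),
      one_tmul_ribbon_nil_mul (lTensor_counit_comulRight t)]
    constructor <;> abel
  | cons c s ih =>
    have hl : ∀ c, (consStep c).rTensor MNSym (comulLeft (s ++ true :: t)) +
        (consStep c).rTensor MNSym (comulLeft (s ++ t)) +
          (consStep c).rTensor MNSym (comulLeft (s ++ false :: t)) =
        (consStep c).rTensor MNSym (comulLeft s) * (comulLeft t + comulRight t) := by
      intro c
      rw [← map_add, ← map_add, ih.1, rTensor_consStep_mul c _ (rTensor_counit_comulLeft s)]
    have hr : ∀ c, (consStep c).lTensor MNSym (comulRight (s ++ true :: t)) +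
        (consStep c).lTensor MNSym (comulRight (s ++ t)) +
          (consStep c).lTensor MNSym (comulRight (s ++ false :: t)) =
        (consStep c).lTensor MNSym (comulRight s) * (comulLeft t + comulRight t) := by
      intro c
      rw [← map_add, ← map_add, ih.2, lTensor_consStep_mul c _ (lTensor_counit_comulRight s)]
    cases c with
    | false =>
      simp only [List.cons_append, comulLeft, comulRight]
      refine ⟨?_, hr false⟩
      rw [add_mul, ← hl, mul_assoc, ← ih.2]
      simp only [mul_add]
      abel
    | true =>
      simp only [List.cons_append, comulLeft, comulRight]
      refine ⟨hl true, ?_⟩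
      rw [add_mul, ← hr, mul_assoc, ← ih.1]
      simp only [mul_add]
      abel

theorem comulRight_replicate (k : ℕ) :
    comulRight (List.replicate k false) = 1 ⊗ₜ ribbon (List.replicate k false) := by
  induction k with
  | zero => simp [comulRight]
  | succ k ih => simp [List.replicate_succ, comulRight, ih, consStep_ribbon]

theorem comulLeft_replicate (k : ℕ) :
    comulLeft (List.replicate k false) =
      ∑ i ∈ Finset.range (k + 1), complete (i + 1) ⊗ₜ complete (k - i) := by
  induction k with
  | zero => simp [comulLeft, complete]
  | succ k ih =>
    rw [List.replicate_succ, comulLeft, ih, comulRight_replicate, Finset.sum_range_succ' _ (k + 1)]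
    congr 1
    · rw [map_sum]
      refine Finset.sum_congr rfl fun i _ => ?_
      rw [LinearMap.rTensor_tmul, complete, consStep_ribbon, complete, ← List.replicate_succ,
        Nat.add_sub_add_right]
    · simp [complete]

end MNSym

/-! ### Multiwords and multishuffles, letter by letter -/

theorem isMultiword_nil_iff {a : List ℕ} : IsMultiword [] a ↔ a = [] := by
  constructor
  · rintro ⟨t, -, ht, -⟩
    by_contra h
    obtain ⟨y, a, rfl⟩ := List.exists_cons_of_ne_nil h
    obtain ⟨j, -⟩ := ht ⟨0, by simp⟩
    exact j.elim0
  · rintro rfl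
    exact ⟨id, monotone_id, Function.surjective_id, fun j => rfl⟩

theorem IsMultiword.mem_iff {w a : List ℕ} (h : IsMultiword w a) {x : ℕ} : x ∈ w ↔ x ∈ a := by
  obtain ⟨t, -, ht, hw⟩ := h
  simp only [List.mem_iff_get]
  constructor
  · rintro ⟨j, rfl⟩
    exact ⟨t j, (hw j).symm⟩
  · rintro ⟨i, rfl⟩
    obtain ⟨j, rfl⟩ := ht i
    exact ⟨j, hw j⟩

theorem isMultiword_cons_cons_iff {x y : ℕ} {w a : List ℕ} :
    IsMultiword (x :: w) (y :: a) ↔ x = y ∧ (IsMultiword w a ∨ IsMultiword w (y :: a)) := by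
  constructor
  · rintro ⟨t, hm, hs, hw⟩
    change Fin (w.length + 1) → Fin (a.length + 1) at t
    have h0 : t 0 = 0 := by
      obtain ⟨j, hj⟩ := hs (0 : Fin (a.length + 1))
      exact le_antisymm (hj ▸ hm (Fin.zero_le j)) (Fin.zero_le _)
    refine ⟨by simpa [h0] using hw (0 : Fin (w.length + 1)), ?_⟩
    by_cases h : ∃ i : Fin w.length, t i.succ = 0
    · right
      refine ⟨fun i => t i.succ, fun i j hij => hm (Fin.succ_le_succ_iff.2 hij), fun k => ?_,
        fun j => hw j.succ⟩
      obtain ⟨i, hi⟩ := h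
      obtain ⟨j, hj⟩ := hs k
      change Fin (w.length + 1) at j
      rcases Fin.eq_zero_or_eq_succ j with rfl | ⟨j, rfl⟩
      · exact ⟨i, by rw [← hj, h0]; exact hi⟩
      · exact ⟨j, hj⟩
    · left
      push Not at h
      refine ⟨fun i => (t i.succ).pred (h i), fun i j hij => ?_, fun k => ?_, fun j => ?_⟩
      · exact Fin.pred_le_pred_iff.2 (hm (Fin.succ_le_succ_iff.2 hij))
      · obtain ⟨j, hj⟩ := hs (Fin.succ k)
        change Fin (w.length + 1) at j
        rcases Fin.eq_zero_or_eq_succ j with rfl | ⟨j, rfl⟩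
        · exact absurd (h0.symm.trans hj).symm (Fin.succ_ne_zero k)
        · exact ⟨j, by simp [hj]⟩
      · have h1 := hw j.succ
        have h2 : t j.succ = ((t j.succ).pred (h j)).succ := by simp
        rw [h2] at h1
        exact h1
  · rintro ⟨rfl, ⟨t, hm, hs, hw⟩ | ⟨t, hm, hs, hw⟩⟩
    · refine ⟨(Fin.cons 0 (fun i => (t i).succ) : Fin (w.length + 1) → Fin (a.length + 1)),
        ?_, ?_, ?_⟩
      · intro i j hij
        change Fin (w.length + 1) at i j
        rcases Fin.eq_zero_or_eq_succ i with rfl | ⟨i, rfl⟩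
        · simp
        rcases Fin.eq_zero_or_eq_succ j with rfl | ⟨j, rfl⟩
        · exact absurd hij (by simp)
        · simpa using hm (Fin.succ_le_succ_iff.1 hij)
      · intro k
        change Fin (a.length + 1) at k
        rcases Fin.eq_zero_or_eq_succ k with rfl | ⟨k, rfl⟩
        · exact ⟨(0 : Fin (w.length + 1)), rfl⟩
        · obtain ⟨j, rfl⟩ := hs k
          exact ⟨j.succ, rfl⟩
      · intro j
        change Fin (w.length + 1) at j
        rcases Fin.eq_zero_or_eq_succ j with rfl | ⟨j, rfl⟩
        · rfl
        · exact hw j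
    · refine ⟨(Fin.cons 0 t : Fin (w.length + 1) → Fin (a.length + 1)), ?_, ?_, ?_⟩
      · intro i j hij
        change Fin (w.length + 1) at i j
        rcases Fin.eq_zero_or_eq_succ i with rfl | ⟨i, rfl⟩
        · simp
        rcases Fin.eq_zero_or_eq_succ j with rfl | ⟨j, rfl⟩
        · exact absurd hij (by simp)
        · simpa using hm (Fin.succ_le_succ_iff.1 hij)
      · intro k
        obtain ⟨j, rfl⟩ := hs k
        exact ⟨j.succ, rfl⟩
      · intro j
        change Fin (w.length + 1) at j
        rcases Fin.eq_zero_or_eq_succ j with rfl | ⟨j, rfl⟩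
        · rfl
        · exact hw j

theorem isMultishuffle_comm {w a b : List ℕ} : IsMultishuffle w a b ↔ IsMultishuffle w b a := by
  simp only [IsMultishuffle, or_comm, and_comm (a := IsMultiword _ a)]

theorem isMultishuffle_nil_iff {a b : List ℕ} : IsMultishuffle [] a b ↔ a = [] ∧ b = [] := by
  simp [IsMultishuffle, isMultiword_nil_iff]

theorem IsMultishuffle.mem_iff {w a b : List ℕ} (h : IsMultishuffle w a b) {x : ℕ} :
    x ∈ w ↔ x ∈ a ∨ x ∈ b := by
  refine ⟨h.1 x, ?_⟩
  rintro (hx | hx)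
  · exact (List.mem_filter.1 (h.2.2.1.mem_iff.2 hx)).1
  · exact (List.mem_filter.1 (h.2.2.2.mem_iff.2 hx)).1

/-- A multishuffle that begins in the first word begins with its first letter, which it may or may
not use again. -/
theorem isMultishuffle_cons_iff {x y : ℕ} {w a b : List ℕ} (hya : y ∉ a)
    (hab : ∀ z ∈ y :: a, z ∉ b) (hx : x ∈ y :: a) :
    IsMultishuffle (x :: w) (y :: a) b ↔
      x = y ∧ w.head? ≠ some y ∧ (IsMultishuffle w a b ∨ IsMultishuffle w (y :: a) b) := by
  have hxb : x ∉ b := hab x hx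
  have hyb : y ∉ b := hab y (by simp)
  have hfilter : y ∉ w → w.filter (fun x => decide (x ∈ y :: a)) =
      w.filter (fun x => decide (x ∈ a)) := by
    intro hyw
    refine List.filter_congr fun z hz => ?_
    have : z ≠ y := fun h => hyw (h ▸ hz)
    simp [this]
  have hchain : (x :: w).IsChain (· ≠ ·) ↔ w.head? ≠ some x ∧ w.IsChain (· ≠ ·) := by
    cases w with
    | nil => simp
    | cons z w => simp [ne_comm]
  rw [IsMultishuffle, List.filter_cons_of_pos (by simpa using hx),
    List.filter_cons_of_neg (by simpa using hxb), isMultiword_cons_cons_iff, hchain]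
  constructor
  · rintro ⟨h1, ⟨h2, h3⟩, ⟨rfl, h4⟩, h5⟩
    refine ⟨rfl, h2, ?_⟩
    rcases h4 with h4 | h4
    · left
      have hxw : x ∉ w := fun h =>
        hya (h4.mem_iff.1 (List.mem_filter.2 ⟨h, by simp⟩))
      rw [hfilter hxw] at h4
      refine ⟨fun z hz => ?_, h3, h4, h5⟩
      rcases h1 z (by simp [hz]) with h | h
      · rcases List.mem_cons.1 h with rfl | h
        · exact absurd hz hxw
        · exact Or.inl h
      · exact Or.inr h
    · exact Or.inr ⟨fun z hz => h1 z (by simp [hz]), h3, h4, h5⟩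
  · rintro ⟨rfl, h2, h | h⟩
    · have hxw : x ∉ w := fun hw => (h.1 x hw).elim hya hyb
      refine ⟨fun z hz => ?_, ⟨h2, h.2.1⟩, ⟨rfl, Or.inl ?_⟩, h.2.2.2⟩
      · rcases List.mem_cons.1 hz with rfl | hz
        · exact Or.inl hx
        · exact (h.1 z hz).imp_left (List.mem_cons_of_mem _)
      · rw [hfilter hxw]; exact h.2.2.1
    · refine ⟨fun z hz => ?_, ⟨h2, h.2.1⟩, ⟨rfl, Or.inr h.2.2.1⟩, h.2.2.2⟩
      rcases List.mem_cons.1 hz with rfl | hz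
      · exact Or.inl hx
      · exact h.1 z hz

/-- The descents of a word: its `i`-th entry says whether `w_i > w_{i+1}`. -/
def wordSteps (w : List ℕ) : List Bool := List.zipWith (fun a b => decide (b < a)) w w.tail

theorem descentComp_cons (x : ℕ) (w : List ℕ) :
    descentComp (x :: w) = ofRibbonSteps (wordSteps (x :: w)) := rfl

/-- The multishuffles of `a` and `b` with the given descents whose first letter belongs to `a`. -/
def firstSet (s : List Bool) (a b : List ℕ) : Set (List ℕ) :=
  {u | IsMultishuffle u a b ∧ (∃ x ∈ u.head?, x ∈ a) ∧ wordSteps u = s}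

theorem firstSet_finite (s : List Bool) (a b : List ℕ) : (firstSet s a b).Finite := by
  refine (finite_multishuffles a b (ofRibbonSteps s)).subset ?_
  rintro u ⟨hu, ⟨x, hx, -⟩, rfl⟩
  cases u with
  | nil => simp at hx
  | cons x u => exact ⟨hu, rfl⟩

theorem firstSet_nil_left (s : List Bool) (b : List ℕ) : firstSet s [] b = ∅ := by
  ext u; simp [firstSet]

theorem firstSet_nil_steps {y : ℕ} {a b : List ℕ} (hya : y ∉ a) (hab : ∀ z ∈ y :: a, z ∉ b) :
    firstSet [] (y :: a) b = if a = [] ∧ b = [] then {[y]} else ∅ := by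
  ext u
  rcases u with _ | ⟨x, _ | ⟨x', u⟩⟩
  · simp only [firstSet, Set.mem_ofPred_eq]
    split_ifs <;> simp
  · by_cases hx : x ∈ y :: a
    · have h := isMultishuffle_cons_iff (w := []) hya hab hx
      simp only [isMultishuffle_nil_iff] at h
      simp only [firstSet, Set.mem_ofPred_eq, h]
      split_ifs with h'
      · simp [h', wordSteps]
      · simp [h']
    · simp only [firstSet, Set.mem_ofPred_eq, List.head?_cons, Option.mem_some_iff,
        exists_eq_left', hx, false_and, and_false, false_iff]
      split_ifs
      · rintro ⟨⟩
        simp at hx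
      · simp
  · simp only [firstSet, Set.mem_ofPred_eq, wordSteps, List.tail_cons, List.zipWith_cons_cons,
      List.cons_ne_nil, and_false, false_iff]
    split_ifs <;> simp

/-- The second letter of a multishuffle that begins in the word `y :: a` is either the next letter
of this word, or a letter of `b`; in the latter case the first letter may be used again. -/
theorem firstSet_cons {c e : Bool} {s : List Bool} {y : ℕ} {a b : List ℕ} (hya : y ∉ a)
    (hab : ∀ z ∈ y :: a, z ∉ b) (he : ∀ z ∈ b, decide (z < y) = e) :
    firstSet (c :: s) (y :: a) b =
      List.cons y '' ({w ∈ firstSet s a b | ∀ z ∈ w.head?, decide (z < y) = c} ∪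
        {w ∈ firstSet s b a ∪ firstSet s b (y :: a) | c = e}) := by
  have hyb : y ∉ b := hab y (by simp)
  have key : ∀ x' w, (IsMultishuffle (y :: x' :: w) (y :: a) b ∧
      wordSteps (y :: x' :: w) = c :: s) ↔
      x' :: w ∈ ({w ∈ firstSet s a b | ∀ z ∈ w.head?, decide (z < y) = c} ∪
        {w ∈ firstSet s b a ∪ firstSet s b (y :: a) | c = e}) := by
    intro x' w
    have hsteps : wordSteps (y :: x' :: w) = decide (x' < y) :: wordSteps (x' :: w) := rfl
    rw [isMultishuffle_cons_iff hya hab (by simp), hsteps, List.cons.injEq]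
    simp only [firstSet, Set.mem_union, Set.mem_ofPred_eq, List.head?_cons, Option.mem_some_iff,
      exists_eq_left', forall_eq', true_and, Option.some.injEq, ne_eq,
      isMultishuffle_comm (a := b)]
    by_cases hx'b : x' ∈ b
    · have h1 : x' ∉ a := fun h => hab x' (by simp [h]) hx'b
      have h2 : x' ≠ y := fun h => hyb (h ▸ hx'b)
      have h3 := he x' hx'b
      simp only [hx'b, h1, h2, h3, not_false_eq_true, true_and, false_and, and_false, false_or]
      tauto
    · simp only [hx'b, false_and, and_false, or_false]
      constructor
      · rintro ⟨⟨h1, h2 | h2⟩, h3, h4⟩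
        · exact ⟨⟨h2, (h2.1 x' (by simp)).resolve_right hx'b, h4⟩, h3⟩
        · have h5 : x' ∈ y :: a := (h2.1 x' (by simp)).resolve_right hx'b
          exact absurd ((isMultishuffle_cons_iff hya hab h5).1 h2).1 h1
      · rintro ⟨⟨h1, h2, h3⟩, h4⟩
        exact ⟨⟨fun h => hya (h ▸ h2), Or.inl h1⟩, h4, h3⟩
  ext u
  rcases u with _ | ⟨x, _ | ⟨x', u⟩⟩
  · simp [firstSet]
  · simp [firstSet, wordSteps]
  · constructor
    · rintro ⟨h1, ⟨x'', h2, h3⟩, h4⟩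
      obtain rfl : x = x'' := by simpa using h2
      obtain ⟨rfl, -⟩ := (isMultishuffle_cons_iff hya hab h3).1 h1
      exact ⟨_, (key x' u).1 ⟨h1, h4⟩, rfl⟩
    · rintro ⟨w, h1, h2⟩
      obtain ⟨rfl, rfl⟩ := List.cons.inj h2
      obtain ⟨h3, h4⟩ := (key x' u).2 h1
      exact ⟨h3, ⟨y, by simp⟩, h4⟩

theorem ncard_firstSet_cons {c e : Bool} {s : List Bool} {y : ℕ} {a b : List ℕ} (hya : y ∉ a)
    (hab : ∀ z ∈ y :: a, z ∉ b) (he : ∀ z ∈ b, decide (z < y) = e) :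
    (firstSet (c :: s) (y :: a) b).ncard =
      {w ∈ firstSet s a b | ∀ z ∈ w.head?, decide (z < y) = c}.ncard +
        if c = e then (firstSet s b a).ncard + (firstSet s b (y :: a)).ncard else 0 := by
  have hyb : y ∉ b := hab y (by simp)
  rw [firstSet_cons hya hab he, Set.ncard_image_of_injective _ List.cons_injective,
    Set.ncard_union_eq _ ((firstSet_finite s a b).subset (Set.sep_subset _ _))
      (((firstSet_finite s b a).union (firstSet_finite s b (y :: a))).subset (Set.sep_subset _ _))]
  · congr 1
    split_ifs with h
    · rw [← Set.ncard_union_eq _ (firstSet_finite s b a) (firstSet_finite s b (y :: a))]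
      · simp only [h, and_true]
        rfl
      · refine Set.disjoint_left.2 fun w h1 h2 => ?_
        have h3 : y ∈ w := h2.1.mem_iff.2 (by simp)
        rcases h1.1.mem_iff.1 h3 with h | h
        · exact hyb h
        · exact hya h
    · simp [h]
  · refine Set.disjoint_left.2 fun w h1 h2 => ?_
    obtain ⟨x, hx, hxa⟩ := h1.1.2.1
    have h3 : ∃ x ∈ w.head?, x ∈ b := h2.1.elim (fun h => h.2.1) (fun h => h.2.1)
    obtain ⟨x', hx', hxb⟩ := h3
    obtain rfl : x = x' := Option.mem_unique hx hx'
    exact hab x (by simp [hxa]) hxb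

theorem head?_of_mem_firstSet {s : List Bool} {y : ℕ} {a b w : List ℕ} (hya : y ∉ a)
    (hab : ∀ z ∈ y :: a, z ∉ b) (hw : w ∈ firstSet s (y :: a) b) : w.head? = some y := by
  obtain ⟨h1, ⟨x, h2, h3⟩, -⟩ := hw
  cases w with
  | nil => simp at h2
  | cons x' w =>
    obtain rfl : x' = x := by simpa using h2
    rw [((isMultishuffle_cons_iff hya hab h3).1 h1).1, List.head?_cons]

theorem ncard_multishuffles {s : List Bool} {a b : List ℕ} (hab : ∀ z ∈ a, z ∉ b) :
    {u | IsMultishuffle u a b ∧ descentComp u = ofRibbonSteps s}.ncard =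
      (firstSet s a b).ncard + (firstSet s b a).ncard := by
  rw [← Set.ncard_union_eq _ (firstSet_finite s a b) (firstSet_finite s b a)]
  · congr 1
    ext u
    cases u with
    | nil => simp [firstSet, descentComp, (ofRibbonSteps_ne_nil s).symm]
    | cons x u =>
      simp only [descentComp_cons, ofRibbonSteps_injective.eq_iff, firstSet, Set.mem_union,
        Set.mem_ofPred_eq, List.head?_cons, Option.mem_some_iff, exists_eq_left',
        isMultishuffle_comm (a := b)]
      constructor
      · rintro ⟨h1, h2⟩
        exact (h1.1 x (by simp)).imp (fun h => ⟨h1, h, h2⟩) (fun h => ⟨h1, h, h2⟩)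
      · rintro (⟨h1, -, h2⟩ | ⟨h1, -, h2⟩) <;> exact ⟨h1, h2⟩
  · refine Set.disjoint_left.2 fun w h1 h2 => ?_
    obtain ⟨x, hx, hxa⟩ := h1.2.1
    obtain ⟨x', hx', hxb⟩ := h2.2.1
    obtain rfl : x = x' := Option.mem_unique hx hx'
    exact hab x hxa hxb

/-! ### The coproduct as the sum of its two halves -/

namespace MNSym

open Coalgebra (counit comul)

/-- The linear form `x ⊗ y ↦ φ(x) ψ(y)`. -/
noncomputable def pairing (φ ψ : MNSym →ₗ[ℤ] ℤ) : MNSym ⊗[ℤ] MNSym →ₗ[ℤ] ℤ :=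
  LinearMap.mul' ℤ ℤ ∘ₗ TensorProduct.map φ ψ

theorem pairing_tmul (φ ψ : MNSym →ₗ[ℤ] ℤ) (x y : MNSym) :
    pairing φ ψ (x ⊗ₜ y) = φ x * ψ y := rfl

theorem pairing_rTensor (φ ψ : MNSym →ₗ[ℤ] ℤ) (f : MNSym →ₗ[ℤ] MNSym) (z : MNSym ⊗[ℤ] MNSym) :
    pairing φ ψ (f.rTensor MNSym z) = pairing (φ ∘ₗ f) ψ z := by
  induction z with
  | zero => simp
  | add x y hx hy => rw [map_add, map_add, map_add, hx, hy]
  | tmul x y => rfl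

theorem pairing_lTensor (φ ψ : MNSym →ₗ[ℤ] ℤ) (f : MNSym →ₗ[ℤ] MNSym) (z : MNSym ⊗[ℤ] MNSym) :
    pairing φ ψ (f.lTensor MNSym z) = pairing φ (ψ ∘ₗ f) z := by
  induction z with
  | zero => simp
  | add x y hx hy => rw [map_add, map_add, map_add, hx, hy]
  | tmul x y => rfl

theorem tmul_one_mul (x : MNSym) (z : MNSym ⊗[ℤ] MNSym) :
    (x ⊗ₜ 1) * z = (LinearMap.mulLeft ℤ x).rTensor MNSym z := by
  induction z with
  | zero => simp
  | add y z hy hz => rw [mul_add, map_add, hy, hz]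
  | tmul y z => simp

theorem one_tmul_mul (x : MNSym) (z : MNSym ⊗[ℤ] MNSym) :
    (1 ⊗ₜ x) * z = (LinearMap.mulLeft ℤ x).lTensor MNSym z := by
  induction z with
  | zero => simp
  | add y z hy hz => rw [mul_add, map_add, hy, hz]
  | tmul y z => simp

theorem pairing_add_left (φ φ' ψ : MNSym →ₗ[ℤ] ℤ) (z : MNSym ⊗[ℤ] MNSym) :
    pairing (φ + φ') ψ z = pairing φ ψ z + pairing φ' ψ z := by
  induction z with
  | zero => simp
  | add x y hx hy => simp only [map_add, hx, hy]; abel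
  | tmul x y => simp [pairing_tmul, add_mul]

theorem pairing_add_right (φ ψ ψ' : MNSym →ₗ[ℤ] ℤ) (z : MNSym ⊗[ℤ] MNSym) :
    pairing φ (ψ + ψ') z = pairing φ ψ z + pairing φ ψ' z := by
  induction z with
  | zero => simp
  | add x y hx hy => simp only [map_add, hx, hy]; abel
  | tmul x y => simp [pairing_tmul, mul_add]

theorem pairing_zero_left (ψ : MNSym →ₗ[ℤ] ℤ) (z : MNSym ⊗[ℤ] MNSym) : pairing 0 ψ z = 0 := by
  induction z with
  | zero => simp
  | add x y hx hy => simp only [map_add, hx, hy]; simp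
  | tmul x y => simp [pairing_tmul]

theorem pairing_zero_right (φ : MNSym →ₗ[ℤ] ℤ) (z : MNSym ⊗[ℤ] MNSym) : pairing φ 0 z = 0 := by
  induction z with
  | zero => simp
  | add x y hx hy => simp only [map_add, hx, hy]; simp
  | tmul x y => simp [pairing_tmul]

/-- The coefficient of the ribbon function of the descent composition of a word. -/
noncomputable def wordCoord (a : List ℕ) : MNSym →ₗ[ℤ] ℤ := ribbonBasis.coord (descentComp a)

theorem coord_R (α β : List ℕ+) : ribbonBasis.coord α (R β) = if β = α then 1 else 0 := by
  rw [R, Module.Basis.coord_apply, Module.Basis.repr_self, Finsupp.single_apply]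

theorem wordCoord_nil_one : wordCoord [] 1 = 1 := by
  rw [wordCoord, one_eq, coord_R]; rfl

theorem wordCoord_nil_ribbon (s : List Bool) : wordCoord [] (ribbon s) = 0 := by
  rw [wordCoord, ribbon, coord_R]
  exact if_neg (ofRibbonSteps_ne_nil s)

theorem wordCoord_cons_one (y : ℕ) (a : List ℕ) : wordCoord (y :: a) 1 = 0 := by
  rw [wordCoord, one_eq, coord_R, if_neg]
  rw [descentComp_cons]
  exact (ofRibbonSteps_ne_nil _).symm

theorem wordCoord_cons_ribbon (y : ℕ) (a : List ℕ) (s : List Bool) :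
    wordCoord (y :: a) (ribbon s) = if s = wordSteps (y :: a) then 1 else 0 := by
  simp only [wordCoord, ribbon, coord_R, descentComp_cons, ofRibbonSteps_injective.eq_iff]

theorem wordSteps_singleton (y : ℕ) : wordSteps [y] = [] := rfl

theorem wordSteps_cons_cons (y z : ℕ) (a : List ℕ) :
    wordSteps (y :: z :: a) = decide (z < y) :: wordSteps (z :: a) := rfl

theorem wordCoord_nil_comp_consStep (c : Bool) : wordCoord [] ∘ₗ consStep c = 0 :=
  linearMap_ext (by simp [consStep_one]) (by simp [consStep_ribbon, wordCoord_nil_ribbon])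

theorem wordCoord_singleton_comp_consStep (y : ℕ) (c : Bool) :
    wordCoord [y] ∘ₗ consStep c = 0 :=
  linearMap_ext (by simp [consStep_one])
    (by simp [consStep_ribbon, wordCoord_cons_ribbon, wordSteps_singleton])

theorem wordCoord_cons_cons_comp_consStep (y z : ℕ) (a : List ℕ) (c : Bool) :
    wordCoord (y :: z :: a) ∘ₗ consStep c =
      if decide (z < y) = c then wordCoord (z :: a) else 0 := by
  refine linearMap_ext ?_ fun s => ?_
  · split_ifs <;> simp [consStep_one, wordCoord_cons_one]
  · simp only [LinearMap.comp_apply, consStep_ribbon, wordCoord_cons_ribbon, wordSteps_cons_cons,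
      List.cons.injEq]
    split_ifs with h1 h2 h2 <;> simp_all [wordCoord_cons_ribbon]

theorem wordCoord_nil_comp_mulLeft : wordCoord [] ∘ₗ LinearMap.mulLeft ℤ (ribbon []) = 0 :=
  linearMap_ext (by simp [wordCoord_nil_ribbon])
    (by simp [ribbon_mul_ribbon, wordCoord_nil_ribbon])

/-- Multiplication by `R̃_(1)` accounts for a first letter that may or may not be used again. -/
theorem wordCoord_cons_comp_mulLeft (y : ℕ) (a : List ℕ) :
    wordCoord (y :: a) ∘ₗ LinearMap.mulLeft ℤ (ribbon []) =
      wordCoord a + wordCoord (y :: a) := by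
  refine linearMap_ext ?_ fun s => ?_
  · cases a <;> simp [wordCoord_cons_one, wordCoord_cons_ribbon, wordCoord_nil_one,
      wordSteps_singleton, wordSteps_cons_cons]
  · simp only [LinearMap.comp_apply, LinearMap.mulLeft_apply, ribbon_mul_ribbon, map_add,
      LinearMap.add_apply, List.nil_append, wordCoord_cons_ribbon]
    cases a with
    | nil => simp [wordCoord_nil_ribbon, wordSteps_singleton]
    | cons z a =>
      rw [wordCoord_cons_ribbon, wordSteps_cons_cons]
      by_cases h : z < y <;> simp [h, add_comm]

theorem comulLeft_cons (c : Bool) (s : List Bool) : comulLeft (c :: s) =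
    (consStep c).rTensor MNSym (comulLeft s) +
      if c = false then (LinearMap.mulLeft ℤ (ribbon [])).rTensor MNSym (comulRight s) else 0 := by
  cases c <;> simp [comulLeft, tmul_one_mul]

theorem comulRight_cons (c : Bool) (s : List Bool) : comulRight (c :: s) =
    (consStep c).lTensor MNSym (comulRight s) +
      if c = true then (LinearMap.mulLeft ℤ (ribbon [])).lTensor MNSym (comulLeft s) else 0 := by
  cases c <;> simp [comulRight, one_tmul_mul]

/-- The coefficients of the two halves of the coproduct count the multishuffles of any two words
with distinct letters such that the letters of the second word are larger than those of the
first. -/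
theorem ncard_firstSet_eq_pairing (s : List Bool) (a b : List ℕ) (ha : a.Nodup) (hb : b.Nodup)
    (hab : ∀ x ∈ a, ∀ y ∈ b, x < y) :
    ((firstSet s a b).ncard : ℤ) = pairing (wordCoord a) (wordCoord b) (comulLeft s) ∧
      ((firstSet s b a).ncard : ℤ) = pairing (wordCoord a) (wordCoord b) (comulRight s) := by
  induction s generalizing a b with
  | nil =>
    have hdisj : ∀ z ∈ a, z ∉ b := fun z h1 h2 => lt_irrefl z (hab z h1 z h2)
    have hdisj' : ∀ z ∈ b, z ∉ a := fun z h1 h2 => lt_irrefl z (hab z h2 z h1)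
    simp only [comulLeft, comulRight, pairing_tmul]
    constructor
    · cases a with
      | nil => simp [firstSet_nil_left, wordCoord_nil_ribbon]
      | cons y a =>
        rw [firstSet_nil_steps (List.nodup_cons.1 ha).1 hdisj, wordCoord_cons_ribbon]
        cases a <;> cases b <;> simp [wordSteps_singleton, wordSteps_cons_cons, wordCoord_nil_one,
          wordCoord_cons_one]
    · cases b with
      | nil => simp [firstSet_nil_left, wordCoord_nil_ribbon]
      | cons y b =>
        rw [firstSet_nil_steps (List.nodup_cons.1 hb).1 hdisj', wordCoord_cons_ribbon]
        cases a <;> cases b <;> simp [wordSteps_singleton, wordSteps_cons_cons, wordCoord_nil_one,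
          wordCoord_cons_one]
  | cons c s ih =>
    have hdisj : ∀ z ∈ a, z ∉ b := fun z h1 h2 => lt_irrefl z (hab z h1 z h2)
    have hdisj' : ∀ z ∈ b, z ∉ a := fun z h1 h2 => lt_irrefl z (hab z h2 z h1)
    have hfilter : ∀ (y z : ℕ) (a b : List ℕ), (z :: a).Nodup → (∀ x ∈ z :: a, x ∉ b) →
        {w ∈ firstSet s (z :: a) b | ∀ x ∈ w.head?, decide (x < y) = c} =
          if decide (z < y) = c then firstSet s (z :: a) b else ∅ := by
      intro y z a b h1 h2
      ext w
      have h3 := fun hw => head?_of_mem_firstSet (s := s) (w := w) (List.nodup_cons.1 h1).1 h2 hw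
      split_ifs with h
      · refine ⟨fun hw => hw.1, fun hw => ⟨hw, ?_⟩⟩
        rw [h3 hw]
        simpa using h
      · simp only [Set.mem_empty_iff_false, iff_false]
        rintro ⟨hw, hw'⟩
        rw [h3 hw] at hw'
        exact h (by simpa using hw')
    rw [comulLeft_cons, comulRight_cons, map_add, map_add, pairing_rTensor, pairing_lTensor]
    constructor
    · cases a with
      | nil =>
        rw [firstSet_nil_left, wordCoord_nil_comp_consStep, pairing_zero_left]
        split_ifs <;> simp [pairing_rTensor, wordCoord_nil_comp_mulLeft, pairing_zero_left]
      | cons y a =>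
        have ha' := List.nodup_cons.1 ha
        have hab' : ∀ x ∈ a, ∀ y ∈ b, x < y := fun x hx => hab x (by simp [hx])
        rw [ncard_firstSet_cons (e := false) ha'.1 hdisj
          (fun z hz => by simpa using (hab y (by simp) z hz).le)]
        push_cast
        congr 1
        · cases a with
          | nil =>
            rw [wordCoord_singleton_comp_consStep, pairing_zero_left]
            simp [firstSet_nil_left]
          | cons z a =>
            rw [hfilter y z a b ha'.2 (fun x hx => hdisj x (by simp [hx])),
              wordCoord_cons_cons_comp_consStep]
            split_ifs
            · exact (ih (z :: a) b ha'.2 hb hab').1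
            · simp [pairing_zero_left]
        · split_ifs
          · rw [pairing_rTensor, wordCoord_cons_comp_mulLeft, pairing_add_left,
              (ih a b ha'.2 hb hab').2, (ih (y :: a) b ha hb hab).2]
          · simp
    · cases b with
      | nil =>
        rw [firstSet_nil_left, wordCoord_nil_comp_consStep, pairing_zero_right]
        split_ifs <;> simp [pairing_lTensor, wordCoord_nil_comp_mulLeft, pairing_zero_right]
      | cons y b =>
        have hb' := List.nodup_cons.1 hb
        have hab' : ∀ x ∈ a, ∀ y ∈ b, x < y := fun x hx z hz => hab x hx z (by simp [hz])
        rw [ncard_firstSet_cons (e := true) hb'.1 hdisj'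
          (fun z hz => by simpa using hab z hz y (by simp))]
        push_cast
        congr 1
        · cases b with
          | nil =>
            rw [wordCoord_singleton_comp_consStep, pairing_zero_right]
            simp [firstSet_nil_left]
          | cons z b =>
            rw [hfilter y z b a hb'.2 (fun x hx => hdisj' x (by simp [hx])),
              wordCoord_cons_cons_comp_consStep]
            split_ifs
            · exact (ih a (z :: b) ha hb'.2 hab').2
            · simp [pairing_zero_right]
        · split_ifs
          · rw [pairing_lTensor, wordCoord_cons_comp_mulLeft, pairing_add_right,
              (ih a b ha hb'.2 hab').1, (ih a (y :: b) ha hb hab).1]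
          · simp

theorem descentComp_map_add (w : List ℕ) (k : ℕ) : descentComp (w.map (· + k)) = descentComp w := by
  cases w with
  | nil => rfl
  | cons x w =>
    rw [List.map_cons, descentComp_cons, descentComp_cons]
    congr 1
    rw [wordSteps, wordSteps, ← List.map_cons (f := (· + k)), ← List.map_tail,
      List.zipWith_map]
    simp

theorem coprodCoeff_ofRibbonSteps (s : List Bool) (β δ : List ℕ+) :
    (coprodCoeff (ofRibbonSteps s) β δ : ℤ) =
      pairing (ribbonBasis.coord β) (ribbonBasis.coord δ) (comulLeft s + comulRight s) := by
  have hlt : ∀ x ∈ compWord β, ∀ y ∈ (compWord δ).map (· + compSize β), x < y := by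
    intro x hx y hy
    have h1 := (compWord_perm β).mem_iff.1 hx
    obtain ⟨z, hz, rfl⟩ := List.mem_map.1 hy
    have h2 := (compWord_perm δ).mem_iff.1 hz
    simp only [List.mem_range'_1] at h1 h2
    omega
  have h := ncard_firstSet_eq_pairing s (compWord β) ((compWord δ).map (· + compSize β))
    ((compWord_perm β).nodup_iff.2 (List.nodup_range' ..))
    (((compWord_perm δ).nodup_iff.2 (List.nodup_range' ..)).map (add_left_injective _)) hlt
  rw [coprodCoeff, ncard_multishuffles fun z h1 h2 => lt_irrefl z (hlt z h1 z h2)]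
  push_cast
  rw [h.1, h.2, map_add]
  simp only [wordCoord, descentComp_map_add, descentComp_compWord]

theorem tensor_ext {z w : MNSym ⊗[ℤ] MNSym}
    (h : ∀ α β, pairing (ribbonBasis.coord α) (ribbonBasis.coord β) z =
      pairing (ribbonBasis.coord α) (ribbonBasis.coord β) w) : z = w := by
  have key : ∀ (z : MNSym ⊗[ℤ] MNSym) (α β : List ℕ+),
      (ribbonBasis.tensorProduct ribbonBasis).repr z (α, β) =
        pairing (ribbonBasis.coord α) (ribbonBasis.coord β) z := by
    intro z α β
    induction z with
    | zero => simp
    | add x y hx hy => rw [map_add, map_add, Finsupp.add_apply, hx, hy]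
    | tmul x y =>
      rw [Module.Basis.tensorProduct_repr_tmul_apply, pairing_tmul, smul_eq_mul, mul_comm]
      rfl
  refine (ribbonBasis.tensorProduct ribbonBasis).ext_elem ?_
  rintro ⟨α, β⟩
  rw [key, key, h]

theorem comul_R (α : List ℕ+) : comul (R := ℤ) (R α) =
    ∑ᶠ p : List ℕ+ × List ℕ+, (coprodCoeff α p.1 p.2 : ℤ) • (R p.1 ⊗ₜ[ℤ] R p.2) :=
  ribbonBasis.constr_basis ℤ _ α

theorem pairing_comul_R (α β δ : List ℕ+) :
    pairing (ribbonBasis.coord β) (ribbonBasis.coord δ) (comul (R := ℤ) (R α)) =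
      coprodCoeff α β δ := by
  have hfin : (Function.support fun p : List ℕ+ × List ℕ+ =>
      (coprodCoeff α p.1 p.2 : ℤ) • (R p.1 ⊗ₜ[ℤ] R p.2)).Finite := by
    refine (finite_coprodCoeff_ne_zero α).subset fun p hp h => hp ?_
    simp [h]
  rw [comul_R, map_finsum _ hfin, finsum_eq_single _ (β, δ)]
  · rw [map_zsmul, pairing_tmul, coord_R, coord_R]
    simp
  · rintro ⟨β', δ'⟩ h
    rw [map_zsmul, pairing_tmul, coord_R, coord_R]
    by_cases h1 : β' = β
    · by_cases h2 : δ' = δ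
      · exact absurd (by rw [h1, h2]) h
      · simp [h2]
    · simp [h1]

theorem comul_ribbon (s : List Bool) :
    comul (R := ℤ) (ribbon s) = comulLeft s + comulRight s :=
  tensor_ext fun β δ => by rw [ribbon, pairing_comul_R, coprodCoeff_ofRibbonSteps]

theorem comul_one : comul (R := ℤ) (1 : MNSym) = 1 ⊗ₜ 1 := by
  refine tensor_ext fun β δ => ?_
  have h : {u : List ℕ | IsMultishuffle u (compWord β) ((compWord δ).map (· + compSize β)) ∧
      descentComp u = []} = if β = [] ∧ δ = [] then {[]} else ∅ := by
    have hnil : ∀ α, compWord α = [] ↔ α = [] := by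
      rintro (_ | ⟨a, l⟩)
      · simp [compWord]
      · simp [compWord]
    ext u
    cases u with
    | nil =>
      have h' := isMultishuffle_nil_iff (a := compWord β) (b := (compWord δ).map (· + compSize β))
      rw [List.map_eq_nil_iff, hnil, hnil] at h'
      simp only [Set.mem_ofPred_eq, h']
      split_ifs with h <;> simp [h, descentComp]
    | cons x u =>
      simp only [Set.mem_ofPred_eq, descentComp_cons, ofRibbonSteps_ne_nil, and_false]
      split_ifs <;> simp
  rw [one_eq, pairing_comul_R, coprodCoeff, h, pairing_tmul, coord_R, coord_R]
  by_cases h1 : β = [] <;> by_cases h2 : δ = [] <;> simp [h1, h2, eq_comm]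

theorem comul_mul (x y : MNSym) :
    comul (R := ℤ) (x * y) = comul (R := ℤ) x * comul (R := ℤ) y := by
  induction x using induction_on with
  | one => rw [one_mul, comul_one, ← Algebra.TensorProduct.one_def, one_mul]
  | add x x' hx hx' => rw [add_mul, map_add, map_add, hx, hx', add_mul]
  | neg x hx =>
    rw [neg_mul, map_neg, map_neg, hx]
    refine neg_eq_of_add_eq_zero_right ?_
    rw [← add_mul, add_neg_cancel, zero_mul]
  | ribbon s =>
    induction y using induction_on with
    | one => rw [mul_one, comul_one, ← Algebra.TensorProduct.one_def, mul_one]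
    | add y y' hy hy' => rw [mul_add, map_add, map_add, hy, hy', mul_add]
    | neg y hy =>
      rw [mul_neg, map_neg, map_neg, hy]
      refine neg_eq_of_add_eq_zero_right ?_
      rw [← mul_add, add_neg_cancel, mul_zero]
    | ribbon t =>
      have h := comulLeft_comulRight_join s t
      simp only [ribbon_mul_ribbon, map_add, comul_ribbon]
      rw [add_mul, ← h.1, ← h.2]
      abel

theorem comul_complete (n : ℕ) : comul (R := ℤ) (complete n) =
    ∑ i ∈ Finset.range (n + 1), complete i ⊗ₜ complete (n - i) := by
  cases n with
  | zero => simp [complete, comul_one]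
  | succ k =>
    rw [complete, comul_ribbon, comulLeft_replicate, comulRight_replicate,
      Finset.sum_range_succ' _ (k + 1)]
    simp [complete]

end MNSym

/-! ### Existence of the antipode -/

namespace MNSym

open Coalgebra (counit comul)

theorem ofSteps_pow_false (k : ℕ) :
    ofSteps (FreeAlgebra.ι ℤ false ^ k) = complete (k + 1) := by
  rw [complete, ← ofSteps_stepWord, stepWord, List.map_replicate, List.prod_replicate]

theorem antipode_complete (k : ℕ) :
    antipode (complete (k + 1)) = -ofSteps ((-(FreeAlgebra.ι ℤ true + 1)) ^ k) := by
  rw [← ofSteps_pow_false, antipode_ofSteps, map_pow, MulOpposite.unop_pow]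
  simp [stepAntipode]

theorem joinStep_eq_sub :
    joinStep = FreeAlgebra.ι ℤ false - (-(FreeAlgebra.ι ℤ true + 1)) := by
  rw [joinStep]; abel

/-- Telescoping: `∑ aⁱ (a - b) bʲ = aᵏ - bᵏ` over `i + j = k - 1`, in any ring. -/
theorem sum_pow_mul_sub_mul_pow {A : Type*} [Ring A] (a b : A) (k : ℕ) :
    ∑ i ∈ Finset.range k, a ^ i * (a - b) * b ^ (k - 1 - i) = a ^ k - b ^ k := by
  have h : ∀ i ∈ Finset.range k, a ^ i * (a - b) * b ^ (k - 1 - i) =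
      a ^ (i + 1) * b ^ (k - (i + 1)) - a ^ i * b ^ (k - i) := by
    intro i hi
    have h1 : k - i = (k - 1 - i) + 1 := by
      have := Finset.mem_range.1 hi
      omega
    have h2 : k - (i + 1) = k - 1 - i := by omega
    rw [h1, h2, pow_succ a, pow_succ' b]
    noncomm_ring
  rw [Finset.sum_congr rfl h, Finset.sum_range_sub (fun i => a ^ i * b ^ (k - i))]
  simp

/-- The convolution of the identity and the antipode on a complete homogeneous element is a
telescoping sum, since `h + v + 1 = h - (-(v + 1))`. -/
theorem sum_complete_mul_antipode (k : ℕ) :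
    ∑ i ∈ Finset.range (k + 1 + 1), complete i * antipode (complete (k + 1 - i)) = 0 := by
  rw [Finset.sum_range_succ', Finset.sum_range_succ]
  have h : ∀ i ∈ Finset.range k, complete (i + 1) * antipode (complete (k + 1 - (i + 1))) =
      -ofSteps (FreeAlgebra.ι ℤ false ^ i * (FreeAlgebra.ι ℤ false -
        (-(FreeAlgebra.ι ℤ true + 1))) * (-(FreeAlgebra.ι ℤ true + 1)) ^ (k - 1 - i)) := by
    intro i hi
    have hi' : k + 1 - (i + 1) = (k - 1 - i) + 1 := by
      have := Finset.mem_range.1 hi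
      omega
    rw [hi', antipode_complete, ← ofSteps_pow_false, mul_neg, ofSteps_mul_ofSteps,
      joinStep_eq_sub]
  rw [Finset.sum_congr rfl h, Finset.sum_neg_distrib, ← map_sum, sum_pow_mul_sub_mul_pow,
    Nat.sub_self, Nat.sub_zero, antipode_complete, ← ofSteps_pow_false]
  simp [complete, antipode_one]

theorem sum_antipode_mul_complete (k : ℕ) :
    ∑ i ∈ Finset.range (k + 1 + 1), antipode (complete i) * complete (k + 1 - i) = 0 := by
  rw [Finset.sum_range_succ', Finset.sum_range_succ]
  have h : ∀ i ∈ Finset.range k, antipode (complete (i + 1)) * complete (k + 1 - (i + 1)) =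
      ofSteps ((-(FreeAlgebra.ι ℤ true + 1)) ^ i * (-(FreeAlgebra.ι ℤ true + 1) -
        FreeAlgebra.ι ℤ false) * FreeAlgebra.ι ℤ false ^ (k - 1 - i)) := by
    intro i hi
    have hi' : k + 1 - (i + 1) = (k - 1 - i) + 1 := by
      have := Finset.mem_range.1 hi
      omega
    rw [hi', antipode_complete, ← ofSteps_pow_false, ← map_neg, ofSteps_mul_ofSteps,
      joinStep_eq_sub]
    congr 1
    noncomm_ring
  rw [Finset.sum_congr rfl h, ← map_sum, sum_pow_mul_sub_mul_pow,
    Nat.sub_self, Nat.sub_zero, antipode_complete, ← ofSteps_pow_false]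
  simp [complete, antipode_one]
  abel

theorem counit_complete_succ (k : ℕ) : counit (R := ℤ) (complete (k + 1)) = 0 :=
  counit_ribbon _

/-- If `w` convolves to a scalar, then so does `z * w`, because the antipode is
anti-multiplicative. -/
theorem mul'_map_id_antipode_mul (z : MNSym ⊗[ℤ] MNSym) {w : MNSym ⊗[ℤ] MNSym} {n : ℤ}
    (hw : LinearMap.mul' ℤ MNSym (TensorProduct.map LinearMap.id antipode w) = n • 1) :
    LinearMap.mul' ℤ MNSym (TensorProduct.map LinearMap.id antipode (z * w)) =
      n • LinearMap.mul' ℤ MNSym (TensorProduct.map LinearMap.id antipode z) := by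
  have key : ∀ a b : MNSym, LinearMap.mul' ℤ MNSym
      (TensorProduct.map LinearMap.id antipode ((a ⊗ₜ b) * w)) =
        a * LinearMap.mul' ℤ MNSym (TensorProduct.map LinearMap.id antipode w) * antipode b := by
    intro a b
    clear hw
    induction w with
    | zero => simp
    | add x y hx hy => simp only [mul_add, map_add, hx, hy, add_mul]
    | tmul x y => simp [antipode_mul, mul_assoc]
  induction z with
  | zero => simp
  | add x y hx hy => simp only [add_mul, map_add, hx, hy, smul_add]
  | tmul a b => rw [key, hw]; simp [mul_assoc, Int.cast_comm]

theorem mul'_map_antipode_id_mul {z : MNSym ⊗[ℤ] MNSym} (w : MNSym ⊗[ℤ] MNSym) {n : ℤ}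
    (hz : LinearMap.mul' ℤ MNSym (TensorProduct.map antipode LinearMap.id z) = n • 1) :
    LinearMap.mul' ℤ MNSym (TensorProduct.map antipode LinearMap.id (z * w)) =
      n • LinearMap.mul' ℤ MNSym (TensorProduct.map antipode LinearMap.id w) := by
  have key : ∀ a b : MNSym, LinearMap.mul' ℤ MNSym
      (TensorProduct.map antipode LinearMap.id (z * (a ⊗ₜ b))) =
        antipode a * LinearMap.mul' ℤ MNSym (TensorProduct.map antipode LinearMap.id z) * b := by
    intro a b
    clear hz
    induction z with
    | zero => simp
    | add x y hx hy => simp only [mul_add, map_add, hx, hy, add_mul]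
    | tmul x y => simp [antipode_mul, mul_assoc]
  induction w with
  | zero => simp
  | add x y hx hy => simp only [mul_add, map_add, hx, hy, smul_add]
  | tmul a b => rw [key, hz]; simp [mul_assoc, Int.cast_comm]

theorem mul'_map_id_antipode_comul (x : MNSym) :
    LinearMap.mul' ℤ MNSym (TensorProduct.map LinearMap.id antipode (comul x)) =
      counit (R := ℤ) x • 1 := by
  have hx : x ∈ Algebra.adjoin ℤ (Set.range complete) := adjoin_complete ▸ Algebra.mem_top
  have hone : LinearMap.mul' ℤ MNSym (TensorProduct.map LinearMap.id antipode
      (comul (1 : MNSym))) = counit (R := ℤ) (1 : MNSym) • 1 := by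
    simp [comul_one, counit_one, antipode_one]
  induction hx using Algebra.adjoin_induction with
  | mem x hx =>
    obtain ⟨n, rfl⟩ := hx
    cases n with
    | zero => exact hone
    | succ k =>
      rw [comul_complete, counit_complete_succ, zero_smul, map_sum, map_sum,
        ← sum_complete_mul_antipode k]
      rfl
  | algebraMap r =>
    rw [Algebra.algebraMap_eq_smul_one, map_zsmul, map_zsmul, map_zsmul, map_zsmul, hone,
      smul_assoc]
  | add x y _ _ hx hy => simp only [map_add, hx, hy, add_smul]
  | mul x y _ _ hx hy =>
    rw [comul_mul, mul'_map_id_antipode_mul _ hy, hx, counit_mul, mul_smul, smul_comm]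

theorem mul'_map_antipode_id_comul (x : MNSym) :
    LinearMap.mul' ℤ MNSym (TensorProduct.map antipode LinearMap.id (comul x)) =
      counit (R := ℤ) x • 1 := by
  have hx : x ∈ Algebra.adjoin ℤ (Set.range complete) := adjoin_complete ▸ Algebra.mem_top
  have hone : LinearMap.mul' ℤ MNSym (TensorProduct.map antipode LinearMap.id
      (comul (1 : MNSym))) = counit (R := ℤ) (1 : MNSym) • 1 := by
    simp [comul_one, counit_one, antipode_one]
  induction hx using Algebra.adjoin_induction with
  | mem x hx =>
    obtain ⟨n, rfl⟩ := hx
    cases n with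
    | zero => exact hone
    | succ k =>
      rw [comul_complete, counit_complete_succ, zero_smul, map_sum, map_sum,
        ← sum_antipode_mul_complete k]
      rfl
  | algebraMap r =>
    rw [Algebra.algebraMap_eq_smul_one, map_zsmul, map_zsmul, map_zsmul, map_zsmul, hone,
      smul_assoc]
  | add x y _ _ hx hy => simp only [map_add, hx, hy, add_smul]
  | mul x y _ _ hx hy =>
    rw [comul_mul, mul'_map_antipode_id_mul _ hx, hy, counit_mul, mul_smul]

theorem isAntipode_antipode : IsAntipode antipode := by
  constructor <;> refine LinearMap.ext fun x => ?_
  · refine (mul'_map_id_antipode_comul x).trans ?_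
    simp
  · refine (mul'_map_antipode_id_comul x).trans ?_
    simp

/-! ### Uniqueness of the antipode -/

/-- A linear map that vanishes on `1` and on the ribbon functions of the ribbons with fewer boxes
sees only the term `R̃_α ⊗ 1` of the coproduct of `R̃_α`. -/
theorem rTensor_comulLeft_comulRight (s : List Bool) (T : MNSym →ₗ[ℤ] MNSym) (h1 : T 1 = 0)
    (h : ∀ t : List Bool, t.length < s.length → T (ribbon t) = 0) :
    T.rTensor MNSym (comulLeft s) = T (ribbon s) ⊗ₜ 1 ∧
      T.rTensor MNSym (comulRight s) = 0 := by
  induction s generalizing T with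
  | nil => simp [comulLeft, comulRight, h1]
  | cons c s ih =>
    have hT := ih T h1 (fun t ht => h t (by simp; omega))
    have hcons := ih (T ∘ₗ consStep c) (by simp [consStep_one])
      (fun t ht => by
        rw [LinearMap.comp_apply, consStep_ribbon]
        exact h _ (by simpa using ht))
    have hmul := ih (T ∘ₗ LinearMap.mulLeft ℤ (ribbon []))
      (by
        rw [LinearMap.comp_apply, LinearMap.mulLeft_apply, mul_one]
        exact h _ (by simp))
      (fun t ht => by
        rw [LinearMap.comp_apply, LinearMap.mulLeft_apply, ribbon_mul_ribbon, map_add, map_add,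
          h _ (by simp; omega), h _ (by simp; omega), h _ (by simp; omega), add_zero, add_zero])
    have hlT : ∀ (f : MNSym →ₗ[ℤ] MNSym) z, T.rTensor MNSym (f.lTensor MNSym z) =
        f.lTensor MNSym (T.rTensor MNSym z) := by
      intro f z
      rw [← LinearMap.comp_apply, ← LinearMap.comp_apply, LinearMap.rTensor_comp_lTensor,
        LinearMap.lTensor_comp_rTensor]
    rw [comulLeft_cons, comulRight_cons, map_add, map_add, hlT, hT.2, map_zero, zero_add,
      ← LinearMap.comp_apply, ← LinearMap.rTensor_comp, hcons.1, LinearMap.comp_apply,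
      consStep_ribbon]
    constructor
    · split_ifs
      · rw [← LinearMap.comp_apply, ← LinearMap.rTensor_comp, hmul.2, add_zero]
      · rw [map_zero, add_zero]
    · split_ifs
      · rw [hlT, hT.1, h s (by simp), TensorProduct.zero_tmul, map_zero]
      · rw [map_zero]

theorem eq_zero_of_mul'_map_id_comul {T : MNSym →ₗ[ℤ] MNSym}
    (hT : ∀ x, LinearMap.mul' ℤ MNSym (T.rTensor MNSym (comul x)) = 0) : T = 0 := by
  have h1 : T 1 = 0 := by simpa [comul_one] using hT 1
  have h : ∀ (n : ℕ) (s : List Bool), s.length = n → T (ribbon s) = 0 := by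
    intro n
    induction n using Nat.strong_induction_on with
    | _ n ih =>
      rintro s rfl
      have h := rTensor_comulLeft_comulRight s T h1 (fun t ht => ih _ ht t rfl)
      simpa [comul_ribbon, h.1, h.2] using hT (ribbon s)
  exact linearMap_ext (by simp [h1]) (fun s => by simp [h _ s rfl])

theorem IsAntipode.eq {S S' : MNSym →ₗ[ℤ] MNSym} (hS : IsAntipode S) (hS' : IsAntipode S') :
    S = S' := by
  refine sub_eq_zero.1 (eq_zero_of_mul'_map_id_comul fun x => ?_)
  rw [LinearMap.rTensor_sub, LinearMap.sub_apply, map_sub, sub_eq_zero]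
  exact LinearMap.congr_fun (hS.2.trans hS'.2.symm) x

end MNSym

theorem mainTheorem1 :
    (∃! S : MNSym →ₗ[ℤ] MNSym, MNSym.IsAntipode S) ∧
      ∀ S : MNSym →ₗ[ℤ] MNSym, MNSym.IsAntipode S →
        ∀ (n : ℕ) (α : List ℕ+), compSize α = n →
          {β : List ℕ+ | mergeCount (conjComp α) β ≠ 0}.Finite ∧
            S (MNSym.R α) =
              (-1 : ℤ) ^ n •
                ∑ᶠ β : List ℕ+, (mergeCount (conjComp α) β : ℤ) • MNSym.R β := by
  refine ⟨⟨MNSym.antipode, MNSym.isAntipode_antipode, fun S hS =>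
    hS.eq MNSym.isAntipode_antipode⟩, ?_⟩
  rintro S hS n α rfl
  rw [hS.eq MNSym.isAntipode_antipode]
  exact ⟨MNSym.finite_mergeCount_ne_zero _, MNSym.antipode_R α⟩
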